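/- Let $K$ be a field of characteristic $2$ and let $n\ge 4$. Let $\mathfrak o_\Pi(2n)$ be the Lie algebra of $2n\times 2n$ matrices $X$ over $K$ with $X^T\Pi+\Pi X=0$, where $\Pi=\begin{pmatrix}0&1_n\\1_n&0\end{pmatrix}$. Its second derived algebra $\mathfrak o_\Pi^{(2)}(2n)$ consists of the matrices $\begin{pmatrix}A&B\\C&A^T\end{pmatrix}$ with $\operatorname{tr}A=0$ and $B,C$ symmetric with zero diagonal. Let $\mathfrak{oc}(2;2n)$ be its central extension $\mathfrak o_\Pi^{(2)}(2n)\oplus Kz$ with central element $z$, in which the bracket of $X$ and $X'$ is $[X,X']+F(X,X')z$, where $$F\left(\begin{pmatrix}A&B\\C&A^T\end{pmatrix},\begin{pmatrix}A'&B'\\C'&A'^T\end{pmatrix}\right)=\sum_{1\le i<j\le n}\left(B_{ij}C'_{ij}+B'_{ij}C_{ij}\right).$$ Put $x_i=E_{i,i+1}+E_{n+i+1,n+i}$ for $1\le i\le n-1$ and $x_n=E_{n-1,2n}+E_{n,2n-1}$, and let $\mathfrak n$ be the Lie subalgebra of $\mathfrak{oc}(2;2n)$ generated by $x_1,\dots,x_n$.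 Then the following are defining relations for $\mathfrak n$ in the generators $x_1,\dots,x_n$; that is, the kernel of the canonical homomorphism from the free Lie algebra over $K$ on $x_1,\dots,x_n$ onto $\mathfrak n$ is the ideal generated by the left-hand sides of: (a) the Serre relations: for $i\ne j$, $[x_i,[x_i,x_j]]=0$ if the nodes $i,j$ of the Dynkin diagram $D_n$ are joined (that is, if $\{i,j\}=\{k,k+1\}$ with $1\le k\le n-2$, or $\{i,j\}=\{n-2,n\}$), and $[x_i,x_j]=0$ otherwise; (b) $[[x_{i-1},x_i],[x_i,x_{i+1}]]=0$ for $2\le i\le n-2$; (c) the four relations $$\begin{aligned} &[[x_{n-3},x_{n-2}],[x_{n-2},x_n]]=0,\\ &[[x_{n-2},x_{n-1}],[x_{n-2},x_n]]=0,\\ &[[x_{n-3},[x_{n-2},x_{n-1}]],[x_n,[x_{n-1},x_{n-2}]]]=0,\\ &[[x_{n-3},[x_{n-2},x_n]],[x_n,[x_{n-1},x_{n-2}]]]=0; \end{aligned}$$ (d) for $1\le i\le n-3$, $$[[x_{n-1},[x_i,[x_{i+1},\dots,[x_{n-3},x_{n-2}]\dots]]],\ [x_n,[x_i,[x_{i+1},\dots,[x_{n-3},x_{n-2}]\dots]]]]=0.$$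 -/

import Mathlib

namespace OrthogonalChar2

attribute [local instance] LieRing.ofAssociativeRing

open Matrix LieAlgebra LieModule.Cohomology

/-! ### Presentations of Lie algebras -/

/-- The elements `f i` generate `L`, and `rels` is a set of defining relations for these
generators: every relation between the `f i` lies in the ideal generated by `rels`,
and every element of `rels` is a relation. -/
def IsPresentedBy {K ι L : Type*} [CommRing K] [LieRing L] [LieAlgebra K L]
    (f : ι → L) (rels : Set (FreeLieAlgebra K ι)) : Prop :=
  Function.Surjective (FreeLieAlgebra.lift K f) ∧
    (FreeLieAlgebra.lift K f).ker = LieSubmodule.lieSpan K (FreeLieAlgebra K ι) rels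

/-! ### The orthogonal Lie algebra of the form `Π` and its second derived algebra -/

section Orthogonal

variable (n : ℕ) (K : Type*) [Field K]

/-- The Lie algebra of `2n × 2n` matrices preserving the bilinear form with Gram matrix
`[[0, 1], [1, 0]]`; in characteristic `2` this is `Xᵀ Π + Π X = 0`. -/
abbrev oPi : LieSubalgebra K (Matrix (Fin n ⊕ Fin n) (Fin n ⊕ Fin n) K) :=
  LieAlgebra.Orthogonal.typeD (Fin n) K

/-- The second derived algebra of `oPi`. -/
abbrev oPi2 : LieIdeal K (oPi n K) := derivedSeries K (oPi n K) 2

variable {n K}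

/-- The pairing `∑_{i < j} C i j * D i j` on `n × n` matrices. -/
def upperPairing (C D : Matrix (Fin n) (Fin n) K) : K :=
  ∑ i, ∑ j ∈ Finset.Ioi i, C i j * D i j

lemma sum_sum_eq_sum_Ioi (f : Fin n → Fin n → K) (h : ∀ i, f i i = 0) :
    ∑ i, ∑ j, f i j = ∑ i, ∑ j ∈ Finset.Ioi i, (f i j + f j i) := by
  have key : ∀ i j : Fin n, f i j = (if i < j then f i j else 0) + (if j < i then f i j else 0) := by
    intro i j
    rcases lt_trichotomy i j with h1 | h1 | h1
    · simp [h1, h1.not_gt]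
    · subst h1; simp [h]
    · simp [h1, h1.not_gt]
  have e : ∀ i : Fin n, Finset.Ioi i = Finset.univ.filter (fun j => i < j) := by
    intro i; ext; simp
  simp_rw [e, Finset.sum_filter]
  conv_lhs => enter [2, i, 2, j]; rw [key i j]
  simp_rw [Finset.sum_add_distrib]
  rw [Finset.sum_comm (f := fun i j => if j < i then f i j else 0)]
  simp_rw [← Finset.sum_add_distrib]
  refine Finset.sum_congr rfl fun i _ => Finset.sum_congr rfl fun j _ => ?_
  split_ifs <;> simp

lemma upperPairing_add_transpose (M D : Matrix (Fin n) (Fin n) K) (hD : Dᵀ = D)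
    (hD0 : ∀ i, D i i = 0) : upperPairing (M + Mᵀ) D = (M * D).trace := by
  have hs : ∀ i j, D j i = D i j := fun i j => congrFun (congrFun hD i) j
  simp only [Matrix.trace, Matrix.diag_apply, Matrix.mul_apply]
  rw [sum_sum_eq_sum_Ioi (fun i j => M i j * D j i) (by simp [hD0])]
  refine Finset.sum_congr rfl fun i _ => Finset.sum_congr rfl fun j _ => ?_
  simp [add_mul, hs i j]

lemma upperPairing_comm (C D : Matrix (Fin n) (Fin n) K) :
    upperPairing C D = upperPairing D C := by
  simp [upperPairing, mul_comm]

/-- Block form of the elements of `oPi` in characteristic `2`. -/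
lemma mem_oPi_iff [CharP K 2] (A B C D : Matrix (Fin n) (Fin n) K) :
    fromBlocks A B C D ∈ oPi n K ↔ D = Aᵀ ∧ Bᵀ = B ∧ Cᵀ = C := by
  have hn : ∀ M : Matrix (Fin n) (Fin n) K, -M = M := fun M => by
    ext i j; exact CharTwo.neg_eq _
  rw [oPi, Orthogonal.typeD, mem_skewAdjointMatricesLieSubalgebra,
    mem_skewAdjointMatricesSubmodule, Matrix.IsSkewAdjoint, Matrix.IsAdjointPair]
  simp only [Orthogonal.JD, fromBlocks_transpose, fromBlocks_multiply, fromBlocks_neg, hn]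
  simp only [mul_zero, mul_one, zero_add, add_zero, zero_mul, one_mul, fromBlocks_inj]
  constructor
  · rintro ⟨h1, h2, h3, h4⟩; exact ⟨h2.symm, h4, h1⟩
  · rintro ⟨rfl, h2, h3⟩; exact ⟨h3, rfl, by simp, h2⟩

/-- Matrices of the form `[[A, B], [C, Aᵀ]]` with `B`, `C` symmetric and zero-diagonal. -/
def IsZD (X : Matrix (Fin n ⊕ Fin n) (Fin n ⊕ Fin n) K) : Prop :=
  X.toBlocks₂₂ = X.toBlocks₁₁ᵀ ∧
    (X.toBlocks₁₂ᵀ = X.toBlocks₁₂ ∧ ∀ i, X.toBlocks₁₂ i i = 0) ∧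
    (X.toBlocks₂₁ᵀ = X.toBlocks₂₁ ∧ ∀ i, X.toBlocks₂₁ i i = 0)

lemma bracket_fromBlocks (A B C D A' B' C' D' : Matrix (Fin n) (Fin n) K) :
    ⁅fromBlocks A B C D, fromBlocks A' B' C' D'⁆ =
      fromBlocks (A * A' + B * C' - (A' * A + B' * C)) (A * B' + B * D' - (A' * B + B' * D))
        (C * A' + D * C' - (C' * A + D' * C)) (C * B' + D * D' - (C' * B + D' * D)) := by
  rw [LieRing.of_associative_ring_bracket, fromBlocks_multiply, fromBlocks_multiply]
  ext (i | i) (j | j) <;> simp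

lemma isZD_bracket [CharP K 2] (X Y : oPi n K) : IsZD (⁅X, Y⁆ : oPi n K).1 := by
  obtain ⟨X, hX⟩ := X
  obtain ⟨Y, hY⟩ := Y
  change IsZD ⁅X, Y⁆
  rw [← fromBlocks_toBlocks X, mem_oPi_iff] at hX
  rw [← fromBlocks_toBlocks Y, mem_oPi_iff] at hY
  rw [← fromBlocks_toBlocks X, ← fromBlocks_toBlocks Y, bracket_fromBlocks]
  obtain ⟨h1, h2, h3⟩ := hX
  obtain ⟨h4, h5, h6⟩ := hY
  rw [h1, h4]
  generalize X.toBlocks₁₁ = A at *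
  generalize X.toBlocks₁₂ = B at *
  generalize X.toBlocks₂₁ = C at *
  generalize Y.toBlocks₁₁ = A' at *
  generalize Y.toBlocks₁₂ = B' at *
  generalize Y.toBlocks₂₁ = C' at *
  have diag : ∀ M : Matrix (Fin n) (Fin n) K, ∀ i, M i i - Mᵀ i i = 0 := by intro M i; simp
  have neg : ∀ M : Matrix (Fin n) (Fin n) K, -M = M := fun M => by
    ext i j; exact CharTwo.neg_eq _
  have sub : ∀ M N : Matrix (Fin n) (Fin n) K, M - N = M + N := fun M N => by
    rw [sub_eq_add_neg, neg]
  refine ⟨?_, ⟨?_, fun i => ?_⟩, ?_, fun i => ?_⟩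
  · simp only [toBlocks_fromBlocks₂₂, toBlocks_fromBlocks₁₁, sub, transpose_add, transpose_mul,
      h2, h3, h5, h6]
    abel
  · simp only [toBlocks_fromBlocks₁₂, sub, transpose_add, transpose_mul, transpose_transpose,
      h2, h5]
    abel
  · have e1 : A * B' + B * A'ᵀ - (A' * B + B' * Aᵀ) =
        (A * B' - (A * B')ᵀ) + (B * A'ᵀ - (B * A'ᵀ)ᵀ) := by
      simp only [transpose_mul, transpose_transpose, h2, h5]; abel
    rw [toBlocks_fromBlocks₁₂, e1, Matrix.add_apply, Matrix.sub_apply, Matrix.sub_apply,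
      diag, diag, add_zero]
  · simp only [toBlocks_fromBlocks₂₁, sub, transpose_add, transpose_mul, transpose_transpose,
      h3, h6]
    abel
  · have e1 : C * A' + Aᵀ * C' - (C' * A + A'ᵀ * C) =
        (C * A' - (C * A')ᵀ) + (Aᵀ * C' - (Aᵀ * C')ᵀ) := by
      simp only [transpose_mul, transpose_transpose, h3, h6]; abel
    rw [toBlocks_fromBlocks₂₁, e1, Matrix.add_apply, Matrix.sub_apply, Matrix.sub_apply,
      diag, diag, add_zero]

lemma isZD_of_mem_one [CharP K 2] (X : oPi n K) (hX : X ∈ derivedSeries K (oPi n K) 1) :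
    IsZD X.1 := by
  have h : X ∈ (derivedSeries K (oPi n K) 1 : Submodule K (oPi n K)) := hX
  rw [coe_derivedSeries_one_eq] at h
  induction h using Submodule.span_induction with
  | mem x hx => obtain ⟨a, b, rfl⟩ := hx; exact isZD_bracket a b
  | zero => refine ⟨?_, ⟨?_, ?_⟩, ?_, ?_⟩ <;> intros <;> rfl
  | add x y h1 h2 hx hy =>
    obtain ⟨a1, ⟨a2, a3⟩, a4, a5⟩ := hx (by rwa [← coe_derivedSeries_one_eq] at h1)
    obtain ⟨b1, ⟨b2, b3⟩, b4, b5⟩ := hy (by rwa [← coe_derivedSeries_one_eq] at h2)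
    refine ⟨?_, ⟨?_, fun i => ?_⟩, ?_, fun i => ?_⟩
    · exact congrArg₂ (· + ·) a1 b1
    · exact congrArg₂ (· + ·) a2 b2
    · exact (congrArg₂ (· + ·) (a3 i) (b3 i)).trans (add_zero _)
    · exact congrArg₂ (· + ·) a4 b4
    · exact (congrArg₂ (· + ·) (a5 i) (b5 i)).trans (add_zero _)
  | smul c x h1 hx =>
    obtain ⟨a1, ⟨a2, a3⟩, a4, a5⟩ := hx (by rwa [← coe_derivedSeries_one_eq] at h1)
    refine ⟨?_, ⟨?_, fun i => ?_⟩, ?_, fun i => ?_⟩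
    · exact congrArg (c • ·) a1
    · exact congrArg (c • ·) a2
    · exact (congrArg (c • ·) (a3 i)).trans (smul_zero _)
    · exact congrArg (c • ·) a4
    · exact (congrArg (c • ·) (a5 i)).trans (smul_zero _)

/-- The underlying `2n × 2n` matrix of an element of `oPi2`. -/
def toMat (X : oPi2 n K) : Matrix (Fin n ⊕ Fin n) (Fin n ⊕ Fin n) K := X.1.1

lemma isZD_toMat [CharP K 2] (X : oPi2 n K) : IsZD (toMat X) :=
  isZD_of_mem_one X.1 (derivedSeriesOfIdeal_antitone ⊤ (by norm_num : 1 ≤ 2) X.2)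

end Orthogonal

section CentralExtension

variable (n : ℕ) (K : Type*) [Field K]

/-- The alternating bilinear form
`F(X, X') = ∑_{i < j} (B i j * C' i j + B' i j * C i j)` on the second derived algebra, where
`B`, `C` are the upper right and lower left blocks of `X`. -/
def formF : oPi2 n K →ₗ[K] oPi2 n K →ₗ[K] K :=
  LinearMap.mk₂ K (fun X Y : oPi2 n K =>
      ∑ i : Fin n, ∑ j ∈ Finset.Ioi i,
        ((toMat X).toBlocks₁₂ i j * (toMat Y).toBlocks₂₁ i j +
          (toMat Y).toBlocks₁₂ i j * (toMat X).toBlocks₂₁ i j))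
      (by
        intro X X' Y
        simp only [← Finset.sum_add_distrib]
        refine Finset.sum_congr rfl fun i _ => Finset.sum_congr rfl fun j _ => ?_
        have h1 : toMat (X + X') = toMat X + toMat X' := rfl
        simp only [h1, toBlocks₁₂, toBlocks₂₁, of_apply, Matrix.add_apply]
        ring)
      (by
        intro c X Y
        simp only [Finset.smul_sum]
        refine Finset.sum_congr rfl fun i _ => Finset.sum_congr rfl fun j _ => ?_
        have h1 : toMat (c • X) = c • toMat X := rfl
        simp only [h1, toBlocks₁₂, toBlocks₂₁, of_apply, Matrix.smul_apply, smul_eq_mul]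
        ring)
      (by
        intro X Y Y'
        simp only [← Finset.sum_add_distrib]
        refine Finset.sum_congr rfl fun i _ => Finset.sum_congr rfl fun j _ => ?_
        have h1 : toMat (Y + Y') = toMat Y + toMat Y' := rfl
        simp only [h1, toBlocks₁₂, toBlocks₂₁, of_apply, Matrix.add_apply]
        ring)
      (by
        intro c X Y
        simp only [Finset.smul_sum]
        refine Finset.sum_congr rfl fun i _ => Finset.sum_congr rfl fun j _ => ?_
        have h1 : toMat (c • Y) = c • toMat Y := rfl
        simp only [h1, toBlocks₁₂, toBlocks₂₁, of_apply, Matrix.smul_apply, smul_eq_mul]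
        ring)

lemma formF_apply (X Y : oPi2 n K) :
    formF n K X Y =
      upperPairing (toMat X).toBlocks₁₂ (toMat Y).toBlocks₂₁ +
        upperPairing (toMat Y).toBlocks₁₂ (toMat X).toBlocks₂₁ := by
  simp only [upperPairing, ← Finset.sum_add_distrib]
  rfl

/-- The trace `tr (A B C)` with the blocks `A`, `B`, `C` taken from `X`, `Y`, `Z`. -/
def trABC (X Y Z : oPi2 n K) : K :=
  ((toMat X).toBlocks₁₁ * (toMat Y).toBlocks₁₂ * (toMat Z).toBlocks₂₁).trace

lemma formF_bracket [CharP K 2] (X Y Z : oPi2 n K) :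
    formF n K ⁅X, Y⁆ Z =
      trABC n K X Y Z + trABC n K Y X Z + trABC n K Y Z X + trABC n K X Z Y := by
  rw [formF_apply]
  have hb : toMat ⁅X, Y⁆ = ⁅toMat X, toMat Y⁆ := rfl
  obtain ⟨x1, ⟨x2, -⟩, x4, -⟩ := isZD_toMat X
  obtain ⟨y1, ⟨y2, -⟩, y4, -⟩ := isZD_toMat Y
  obtain ⟨-, ⟨z2, z3⟩, z4, z5⟩ := isZD_toMat Z
  rw [hb, ← fromBlocks_toBlocks (toMat X), ← fromBlocks_toBlocks (toMat Y), bracket_fromBlocks]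
  rw [toBlocks_fromBlocks₁₂, toBlocks_fromBlocks₂₁, x1, y1]
  simp only [trABC]
  generalize (toMat X).toBlocks₁₁ = A at *
  generalize (toMat X).toBlocks₁₂ = B at *
  generalize (toMat X).toBlocks₂₁ = C at *
  generalize (toMat Y).toBlocks₁₁ = A' at *
  generalize (toMat Y).toBlocks₁₂ = B' at *
  generalize (toMat Y).toBlocks₂₁ = C' at *
  generalize (toMat Z).toBlocks₁₂ = B'' at *
  generalize (toMat Z).toBlocks₂₁ = C'' at *
  have sub : ∀ M N : Matrix (Fin n) (Fin n) K, M - N = M + N := fun M N => by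
    ext i j; exact CharTwo.sub_eq_add _ _
  have e1 : A * B' + B * A'ᵀ - (A' * B + B' * Aᵀ) = (A * B' + A' * B) + (A * B' + A' * B)ᵀ := by
    simp only [sub, transpose_add, transpose_mul, x2, y2]; abel
  have e2 : C * A' + Aᵀ * C' - (C' * A + A'ᵀ * C) = (C * A' + C' * A) + (C * A' + C' * A)ᵀ := by
    simp only [sub, transpose_add, transpose_mul, x4, y4]; abel
  rw [e1, e2, upperPairing_comm B'', upperPairing_add_transpose _ _ z4 z5,
    upperPairing_add_transpose _ _ z2 z3]
  simp only [add_mul, trace_add]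
  rw [Matrix.mul_assoc C A' B'', Matrix.trace_mul_comm C, Matrix.mul_assoc C' A B'',
    Matrix.trace_mul_comm C']
  ring

lemma formF_comm (X Y : oPi2 n K) : formF n K X Y = formF n K Y X := by
  rw [formF_apply, formF_apply, add_comm]

lemma formF_self [CharP K 2] (X : oPi2 n K) : formF n K X X = 0 := by
  rw [formF_apply, CharTwo.add_self_eq_zero]

lemma formF_cocycle [CharP K 2] (X Y Z : oPi2 n K) :
    formF n K X ⁅Y, Z⁆ = formF n K ⁅X, Y⁆ Z + formF n K Y ⁅X, Z⁆ := by
  rw [formF_comm n K X ⁅Y, Z⁆, formF_comm n K Y ⁅X, Z⁆, formF_bracket, formF_bracket,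
    formF_bracket]
  linear_combination -(CharTwo.add_self_eq_zero (trABC n K X Y Z)) -
    CharTwo.add_self_eq_zero (trABC n K X Z Y)

/-- The form `F` as an alternating `2`-cochain with values in the trivial module `K`. -/
def cochainF [CharP K 2] : twoCochain K (oPi2 n K) (TrivialLieModule K (oPi2 n K) K) where
  val := (formF n K).compr₂ (TrivialLieModule.equiv K (oPi2 n K) K).symm.toLinearMap
  property X := by
    rw [LinearMap.compr₂_apply, formF_self, map_zero]

lemma cochainF_apply [CharP K 2] (X Y : oPi2 n K) :
    cochainF n K X Y = (TrivialLieModule.equiv K (oPi2 n K) K).symm (formF n K X Y) := rfl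

/-- The `2`-cocycle `F` on the second derived algebra. -/
def cocycleF [CharP K 2] : twoCocycle K (oPi2 n K) (TrivialLieModule K (oPi2 n K) K) :=
  ⟨cochainF n K, by
    rw [mem_twoCocycle_iff_of_trivial]
    intro X Y Z
    rw [cochainF_apply, cochainF_apply, cochainF_apply, formF_cocycle, map_add]⟩

/-- The central extension of `oPi2` by the one-dimensional center `K z` with cocycle `F`:
pairs `(X, c)` with the bracket `⁅(X, c), (X', c')⁆ = (⁅X, X'⁆, F(X, X'))`. -/
abbrev oc [CharP K 2] : Type _ := LieAlgebra.ofTwoCocycle (cocycleF n K)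

end CentralExtension

section Generators

variable {n : ℕ} {K : Type*} [Field K]

/-- The matrix `[[E_{ij}, 0], [0, E_{ji}]]`, that is `E_{i,j} + E_{n+j,n+i}`. -/
def matA (i j : Fin n) : Matrix (Fin n ⊕ Fin n) (Fin n ⊕ Fin n) K :=
  single (Sum.inl i) (Sum.inl j) 1 + single (Sum.inr j) (Sum.inr i) 1

/-- The matrix `[[0, E_{ij} + E_{ji}], [0, 0]]`, that is `E_{i,n+j} + E_{j,n+i}`. -/
def matB (i j : Fin n) : Matrix (Fin n ⊕ Fin n) (Fin n ⊕ Fin n) K :=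
  single (Sum.inl i) (Sum.inr j) 1 + single (Sum.inl j) (Sum.inr i) 1

/-- The matrix `[[0, 0], [E_{ij} + E_{ji}, 0]]`. -/
def matC (i j : Fin n) : Matrix (Fin n ⊕ Fin n) (Fin n ⊕ Fin n) K :=
  single (Sum.inr i) (Sum.inl j) 1 + single (Sum.inr j) (Sum.inl i) 1

lemma matA_eq (i j : Fin n) :
    (matA i j : Matrix _ _ K) = fromBlocks (single i j 1) 0 0 (single j i 1) := by
  ext (a | a) (b | b) <;> simp [matA, single_apply]

lemma matB_eq (i j : Fin n) :
    (matB i j : Matrix _ _ K) = fromBlocks 0 (single i j 1 + single j i 1) 0 0 := by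
  ext (a | a) (b | b) <;> simp [matB, single_apply]

lemma matC_eq (i j : Fin n) :
    (matC i j : Matrix _ _ K) = fromBlocks 0 0 (single i j 1 + single j i 1) 0 := by
  ext (a | a) (b | b) <;> simp [matC, single_apply]

lemma matA_mem [CharP K 2] (i j : Fin n) : (matA i j : Matrix _ _ K) ∈ oPi n K := by
  rw [matA_eq, mem_oPi_iff]; simp

lemma matB_mem [CharP K 2] (i j : Fin n) : (matB i j : Matrix _ _ K) ∈ oPi n K := by
  rw [matB_eq, mem_oPi_iff]; simp [add_comm]

lemma matC_mem [CharP K 2] (i j : Fin n) : (matC i j : Matrix _ _ K) ∈ oPi n K := by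
  rw [matC_eq, mem_oPi_iff]; simp [add_comm]

lemma bracket_mem_derived {k : ℕ} {X Y Z : Matrix (Fin n ⊕ Fin n) (Fin n ⊕ Fin n) K}
    (hX : X ∈ oPi n K) (hY : Y ∈ oPi n K) (hZ : Z ∈ oPi n K)
    (hX' : ⟨X, hX⟩ ∈ derivedSeries K (oPi n K) k) (hY' : ⟨Y, hY⟩ ∈ derivedSeries K (oPi n K) k)
    (h : ⁅X, Y⁆ = Z) : ⟨Z, hZ⟩ ∈ derivedSeries K (oPi n K) (k + 1) := by
  have e : (⟨Z, hZ⟩ : oPi n K) = ⁅(⟨X, hX⟩ : oPi n K), (⟨Y, hY⟩ : oPi n K)⁆ :=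
    Subtype.ext h.symm
  rw [e, derivedSeries_def, derivedSeriesOfIdeal_succ]
  exact LieSubmodule.lie_mem_lie hX' hY'

lemma sub_eq_add_of_charTwo [CharP K 2] (M N : Matrix (Fin n) (Fin n) K) : M - N = M + N := by
  ext i j; exact CharTwo.sub_eq_add _ _

lemma neg_eq_of_charTwo [CharP K 2] (M : Matrix (Fin n) (Fin n) K) : -M = M := by
  ext i j; exact CharTwo.neg_eq _

lemma matB_mem_one [CharP K 2] (i j : Fin n) (h : i ≠ j) :
    ⟨matB i j, matB_mem i j⟩ ∈ derivedSeries K (oPi n K) 1 := by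
  refine bracket_mem_derived (k := 0) (matA_mem i i) (matB_mem i j) _ trivial trivial ?_
  rw [matA_eq, matB_eq, bracket_fromBlocks]
  simp [mul_add, add_mul, h, h.symm]
  exact sub_eq_add_of_charTwo _ _

lemma matC_mem_one [CharP K 2] (i j : Fin n) (h : i ≠ j) :
    ⟨matC i j, matC_mem i j⟩ ∈ derivedSeries K (oPi n K) 1 := by
  refine bracket_mem_derived (k := 0) (matC_mem i j) (matA_mem i i) _ trivial trivial ?_
  rw [matA_eq, matC_eq, bracket_fromBlocks]
  simp [mul_add, add_mul, h, h.symm]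
  rw [sub_eq_add_of_charTwo, add_comm]

lemma matA_mem_two [CharP K 2] (i j k : Fin n) (hij : i ≠ j) (hik : i ≠ k) (hkj : k ≠ j) :
    ⟨matA i j, matA_mem i j⟩ ∈ oPi2 n K := by
  refine bracket_mem_derived (k := 1) (matB_mem i k) (matC_mem k j) _
    (matB_mem_one i k hik) (matC_mem_one k j hkj) ?_
  rw [matA_eq, matB_eq, matC_eq, bracket_fromBlocks]
  simp [mul_add, add_mul, hij, hik, hkj, hij.symm, hik.symm, hkj.symm]
  exact neg_eq_of_charTwo _

lemma matB_mem_two [CharP K 2] (i j k : Fin n) (hij : i ≠ j) (hik : i ≠ k) (hkj : k ≠ j) :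
    ⟨matB i j, matB_mem i j⟩ ∈ oPi2 n K := by
  refine bracket_mem_derived (k := 1) (matA_mem i k) (matB_mem k j) _
    (derivedSeriesOfIdeal_antitone ⊤ (by norm_num : 1 ≤ 2) (matA_mem_two i k j hik hij hkj.symm))
    (matB_mem_one k j hkj) ?_
  rw [matA_eq, matB_eq, matB_eq, bracket_fromBlocks]
  simp [mul_add, add_mul, hkj, hkj.symm]
  exact sub_eq_add_of_charTwo _ _

lemma exists_third (hn : 4 ≤ n) (i j : Fin n) : ∃ k : Fin n, i ≠ k ∧ k ≠ j := by
  by_contra! h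
  have h0 := h ⟨0, by omega⟩
  have h1 := h ⟨1, by omega⟩
  have h2 := h ⟨2, by omega⟩
  simp only [ne_eq, Fin.ext_iff] at h0 h1 h2
  omega

lemma matA_mem_oPi2 [CharP K 2] (hn : 4 ≤ n) (i j : Fin n) (h : i ≠ j) :
    ⟨matA i j, matA_mem i j⟩ ∈ oPi2 n K := by
  obtain ⟨k, h1, h2⟩ := exists_third hn i j
  exact matA_mem_two i j k h h1 h2

lemma matB_mem_oPi2 [CharP K 2] (hn : 4 ≤ n) (i j : Fin n) (h : i ≠ j) :
    ⟨matB i j, matB_mem i j⟩ ∈ oPi2 n K := by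
  obtain ⟨k, h1, h2⟩ := exists_third hn i j
  exact matB_mem_two i j k h h1 h2

/-- The positive Chevalley generators as matrices (indices from `0`): with the usual numbering
from `1`, `x_i = E_{i,i+1} + E_{n+i+1,n+i}` for `i ≤ n - 1`, and
`x_n = E_{n-1,2n} + E_{n,2n-1}`. -/
def xMat [CharP K 2] (hn : 4 ≤ n) (i : Fin n) : oPi2 n K :=
  if h : i.val + 1 < n then
    ⟨⟨matA i ⟨i.val + 1, h⟩, matA_mem _ _⟩,
      matA_mem_oPi2 hn _ _ (by simp [Fin.ext_iff])⟩
  else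
    ⟨⟨matB ⟨n - 2, by omega⟩ ⟨n - 1, by omega⟩, matB_mem _ _⟩,
      matB_mem_oPi2 hn _ _ (by simp only [ne_eq, Fin.ext_iff]; omega)⟩

/-- The positive Chevalley generators of the central extension (no component along `z`). -/
def ocX [CharP K 2] (hn : 4 ≤ n) (i : Fin n) : oc n K :=
  LieAlgebra.ofProd (cocycleF n K) (xMat hn i, 0)

variable (K) in
/-- The positive part `𝔫` of the central extension: the subalgebra generated by the `x_i`. -/
def ocN [CharP K 2] (hn : 4 ≤ n) : LieSubalgebra K (oc n K) :=
  LieSubalgebra.lieSpan K (oc n K) (Set.range (ocX hn))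

variable (K) in
/-- The generators `x_i` as elements of `𝔫`. -/
def nX [CharP K 2] (hn : 4 ≤ n) (i : Fin n) : ocN K hn :=
  ⟨ocX hn i, LieSubalgebra.subset_lieSpan ⟨i, rfl⟩⟩

end Generators

section Relations

variable (n : ℕ) (K : Type*) [Field K]

/-- The Cartan matrix: the one of type `D_n` with its entries reduced to the field `K`
(in characteristic `2` the diagonal is zero and the nonzero off-diagonal entries are `1`). -/
def cartan : Matrix (Fin n) (Fin n) K := (CartanMatrix.D n).map (Int.cast : ℤ → K)

open Classical in
/-- The exponents in the Serre relations when `p = 2` and all `A i i = 0`: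
`B i j = p - 1 = 1` if `A i j ≠ 0`, and `B i j = 0` otherwise. -/
noncomputable def serreB (i j : Fin n) : ℕ := if cartan n K i j = 0 then 0 else 1

/-- The Serre relations `(ad x_i) ^ (1 + B i j) x_j = 0`, `i ≠ j`, for the positive part. -/
def serreRelations : Set (FreeLieAlgebra K (Fin n)) :=
  {r | ∃ i j : Fin n, i ≠ j ∧
    r = ((LieAlgebra.ad K (FreeLieAlgebra K (Fin n)) (FreeLieAlgebra.of K i)) ^
      (1 + serreB n K i j)) (FreeLieAlgebra.of K j)}

/-- The free generator numbered `k`, `1 ≤ k ≤ n` (and `0` for other `k`, which do not occur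
in the relations below). -/
noncomputable def X (k : ℕ) : FreeLieAlgebra K (Fin n) :=
  if h : 1 ≤ k ∧ k ≤ n then FreeLieAlgebra.of K ⟨k - 1, by omega⟩ else 0

/-- The iterated bracket `[x_i, [x_{i+1}, …, [x_{i+m-1}, x_{i+m}]…]]`. -/
noncomputable def nested (i : ℕ) : ℕ → FreeLieAlgebra K (Fin n)
  | 0 => X n K i
  | m + 1 => ⁅X n K i, nested (i + 1) m⁆

/-- The non-Serre relations. -/
def nonSerreRelations : Set (FreeLieAlgebra K (Fin n)) :=
  {r | ∃ i, 2 ≤ i ∧ i ≤ n - 2 ∧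
    r = ⁅⁅X n K (i - 1), X n K i⁆, ⁅X n K i, X n K (i + 1)⁆⁆} ∪
  {⁅⁅X n K (n - 3), X n K (n - 2)⁆, ⁅X n K (n - 2), X n K n⁆⁆,
    ⁅⁅X n K (n - 2), X n K (n - 1)⁆, ⁅X n K (n - 2), X n K n⁆⁆,
    ⁅⁅X n K (n - 3), ⁅X n K (n - 2), X n K (n - 1)⁆⁆,
      ⁅X n K n, ⁅X n K (n - 1), X n K (n - 2)⁆⁆⁆,
    ⁅⁅X n K (n - 3), ⁅X n K (n - 2), X n K n⁆⁆,
      ⁅X n K n, ⁅X n K (n - 1), X n K (n - 2)⁆⁆⁆} ∪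
  {r | ∃ i, 1 ≤ i ∧ i ≤ n - 3 ∧
    r = ⁅⁅X n K (n - 1), nested n K i (n - 2 - i)⁆, ⁅X n K n, nested n K i (n - 2 - i)⁆⁆}

end Relations

end OrthogonalChar2

/-! The argument is a dimension count by roots. Reverse the diagram: `z k` is `x_{n-1-k}`, of weight
`ε_{k+1} - ε_k`, and `t = x_n` has weight `ε_1 + ε_0`. The positive roots of `D_n` are then `ε_p -
ε_q` and `ε_p + ε_q` with `q < p`, and each gets one Lie word in the generators: `seg z q d` for
`ε_{q+d+1} - ε_q`, and `bent z t i q` for `ε_{i+1} + ε_q`.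

Upper bound: in any Lie algebra satisfying the relations, bracketing a root word with a generator
gives zero or another root word (`lie_chain_rootElement`, `lie_end_rootElement`), so the root words
span. In characteristic 2 the Serre relations are too weak for this: `(ad u)^2` is a derivation, so
it yields no information on the cross terms `⁅⁅u, v⁆, ⁅u, w⁆⁆`. Relations (b), (c) and (d) supply
the missing vanishing: (d), with the relation `fork` from (c), kills the words of weight `2ε_p`.

Lower bound: the matrices satisfy the relations (`isFork_root`), and the root words map to linearly
independent matrices (`eq_zero_of_sum_rootMat_eq_zero`). The center plays no role: the generators
have zero lower left block, so `F` vanishes on the subalgebra they generate and its matrix part is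
faithful (`lift_nX_eq_zero_iff`).

A word in the kernel is congruent, modulo the ideal of relations, to a combination of root words;
its matrix image is zero, so all coefficients vanish (`isPresentedBy_nX`). -/

namespace OrthogonalChar2

/-! ### Chains of type `A` -/

section Chain

variable {L : Type*} [LieRing L]

/-- The nested bracket `⁅z (q + d), ⁅…, ⁅z (q + 1), z q⁆…⁆⁆`. -/
def seg (z : ℕ → L) (q : ℕ) : ℕ → L
  | 0 => z q
  | d + 1 => ⁅z (q + d + 1), seg z q d⁆

/-- The defining relations of type `A` in characteristic `2`, for an infinite chain. -/
structure IsChain (z : ℕ → L) : Prop where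
  far : ∀ i j, i + 2 ≤ j → ⁅z i, z j⁆ = 0
  serre : ∀ i, ⁅z i, ⁅z i, z (i + 1)⁆⁆ = 0
  serre' : ∀ i, ⁅z (i + 1), ⁅z (i + 1), z i⁆⁆ = 0
  mid : ∀ i, ⁅⁅z (i + 2), z (i + 1)⁆, ⁅z (i + 1), z i⁆⁆ = 0

lemma lie_comm_of_two (h2 : ∀ u : L, u + u = 0) (u v : L) : ⁅u, v⁆ = ⁅v, u⁆ := by
  rw [← lie_skew u v, neg_eq_iff_add_eq_zero, h2]

lemma lie_eq_zero_swap {u v : L} (h : ⁅u, v⁆ = 0) : ⁅v, u⁆ = 0 := by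
  rw [← lie_skew, h, neg_zero]

lemma lie_lie_left_comm {u v : L} (h : ⁅u, v⁆ = 0) (w : L) : ⁅u, ⁅v, w⁆⁆ = ⁅v, ⁅u, w⁆⁆ := by
  rw [leibniz_lie, h, zero_lie, zero_add]

lemma lie_lie_eq_zero {u v w : L} (h : ⁅u, v⁆ = 0) (h' : ⁅u, w⁆ = 0) : ⁅u, ⁅v, w⁆⁆ = 0 := by
  rw [lie_lie_left_comm h, h', lie_zero]

/-- In characteristic `2` the square of an inner derivation is a derivation. -/
lemma sq_lie_eq_zero (h2 : ∀ u : L, u + u = 0) {u v w : L} (hv : ⁅u, ⁅u, v⁆⁆ = 0)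
    (hw : ⁅u, ⁅u, w⁆⁆ = 0) : ⁅u, ⁅u, ⁅v, w⁆⁆⁆ = 0 := by
  -- The cross term `⁅⁅u, v⁆, ⁅u, w⁆⁆` appears twice.
  rw [leibniz_lie u v w, lie_add, leibniz_lie u ⁅u, v⁆, leibniz_lie u v, hv, hw, zero_lie,
    lie_zero, zero_add, add_zero, h2]

/-- If `u` and `v` centralize `w`, then a triple bracket passes to the first factor of
`⁅p, w⁆`. -/
lemma triple_lie {u v w : L} (hu : ⁅u, w⁆ = 0) (hv : ⁅v, w⁆ = 0) (p : L) :
    ⁅u, ⁅v, ⁅u, ⁅p, w⁆⁆⁆⁆ = ⁅⁅u, ⁅v, ⁅u, p⁆⁆⁆, w⁆ := by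
  rw [leibniz_lie u p, hu, lie_zero, add_zero, leibniz_lie v, hv, lie_zero, add_zero,
    leibniz_lie u, hu, lie_zero, add_zero]

namespace IsChain

variable {z : ℕ → L} (hz : IsChain z)

include hz in
lemma far' (i j : ℕ) (h : j + 2 ≤ i) : ⁅z i, z j⁆ = 0 := lie_eq_zero_swap (hz.far j i h)

-- By the Leibniz rule this is `mid` plus a term killed by `serre'`. The Serre relations alone would
-- give only twice `mid`.
include hz in
lemma triple (i : ℕ) : ⁅z (i + 1), ⁅z (i + 2), ⁅z (i + 1), z i⁆⁆⁆ = 0 := by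
  rw [leibniz_lie, hz.serre', lie_zero, add_zero, ← lie_skew (z (i + 1)), neg_lie, hz.mid,
    neg_zero]

end IsChain
end Chain

/-! ### Brackets inside a chain of type `A` -/

section
variable {L : Type*} [LieRing L]
namespace IsChain
variable {z : ℕ → L} (hz : IsChain z)

include hz in
lemma lie_seg_of_lt (k q d : ℕ) (h : k + 2 ≤ q) : ⁅z k, seg z q d⁆ = 0 := by
  induction d with
  | zero => exact hz.far _ _ h
  | succ d ih => exact lie_lie_eq_zero (hz.far _ _ (by omega)) ih

include hz in
lemma lie_seg_of_gt (k q d : ℕ) (h : q + d + 2 ≤ k) : ⁅z k, seg z q d⁆ = 0 := by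
  induction d with
  | zero => exact hz.far' _ _ h
  | succ d ih => exact lie_lie_eq_zero (hz.far' _ _ (by omega)) (ih (by omega))

include hz in
lemma lie_seg_bot (k d : ℕ) (h2 : ∀ u : L, u + u = 0) :
    ⁅z k, seg z (k + 1) d⁆ = seg z k (d + 1) := by
  induction d with
  | zero => exact lie_comm_of_two h2 _ _
  | succ d ih =>
    rw [seg, lie_lie_left_comm (hz.far _ _ (by omega)), ih, show k + 1 + d + 1 = k + (d + 1) + 1 by
      omega]
    rfl

include hz in
lemma sq_lie (i j : ℕ) : ⁅z i, ⁅z i, z j⁆⁆ = 0 := by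
  rcases lt_trichotomy i j with h | rfl | h
  · rcases Nat.lt_or_ge (i + 1) j with h' | h'
    · rw [hz.far _ _ h', lie_zero]
    · obtain rfl : j = i + 1 := by omega
      exact hz.serre i
  · rw [lie_self, lie_zero]
  · rcases Nat.lt_or_ge (j + 1) i with h' | h'
    · rw [hz.far' _ _ h', lie_zero]
    · obtain rfl : i = j + 1 := by omega
      exact hz.serre' j

include hz in
lemma sq_lie_seg (h2 : ∀ u : L, u + u = 0) (k q d : ℕ) : ⁅z k, ⁅z k, seg z q d⁆⁆ = 0 := by
  induction d with
  | zero => exact hz.sq_lie _ _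
  | succ d ih => exact sq_lie_eq_zero h2 (hz.sq_lie _ _) ih

-- At either end of the segment `z k` acts twice, and `(ad (z k))^2` kills segments. One step below
-- the top, `triple_lie` reduces to `triple`; further down, `z k` commutes with the outer factors,
-- which are peeled off by induction.
include hz in
lemma lie_seg_mid (h2 : ∀ u : L, u + u = 0) (k q d : ℕ) (h1 : q ≤ k) (h3 : k ≤ q + d) :
    ⁅z k, seg z q d⁆ = 0 := by
  rcases h1.eq_or_lt with rfl | h1
  · cases d with
    | zero => exact lie_self _
    | succ d => rw [← hz.lie_seg_bot _ _ h2]; exact hz.sq_lie_seg h2 _ _ _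
  induction d with
  | zero => omega
  | succ d ih =>
    rcases Nat.lt_or_ge k (q + d) with h4 | h4
    · exact lie_lie_eq_zero (hz.far _ _ (by omega)) (ih (by omega))
    rcases Nat.lt_or_ge (q + d) k with h5 | h5
    · obtain rfl : k = q + d + 1 := by omega
      exact hz.sq_lie_seg h2 _ _ _
    obtain rfl : k = q + d := by omega
    obtain ⟨e, rfl⟩ : ∃ e, d = e + 1 := ⟨d - 1, by omega⟩
    rw [seg, seg, show q + (e + 1) = q + e + 1 by omega]
    cases e with
    | zero => exact hz.triple q
    | succ e =>
      rw [seg, triple_lie (hz.lie_seg_of_gt _ _ _ (by omega))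
        (hz.lie_seg_of_gt _ _ _ (by omega)), show q + (e + 1) = q + e + 1 by omega, hz.triple,
        zero_lie]

-- Every factor of the inner segment lies within the range of the outer one and kills it by
-- `lie_seg_mid`.
include hz in
lemma lie_seg_seg (h2 : ∀ u : L, u + u = 0) (q d i : ℕ) (h1 : 0 < q) (h3 : q + d ≤ i) :
    ⁅seg z q d, seg z 0 i⁆ = 0 := by
  induction d with
  | zero => exact hz.lie_seg_mid h2 _ _ _ (by omega) (by omega)
  | succ d ih =>
    rw [seg, lie_lie, ih (by omega), hz.lie_seg_mid h2 _ _ _ (by omega) (by omega), lie_zero,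
      lie_zero, sub_zero]

end IsChain

/-- The defining relations of type `D` in characteristic `2`, for an infinite chain `z` with
a second end `t`. -/
structure IsFork (z : ℕ → L) (t : L) : Prop where
  two : ∀ u : L, u + u = 0
  chain : IsChain z
  chain' : IsChain (Function.update z 0 t)
  ends : ⁅z 0, t⁆ = 0
  fork : ⁅⁅z 1, z 0⁆, ⁅z 1, t⁆⁆ = 0
  left : ⁅⁅z 2, ⁅z 1, z 0⁆⁆, ⁅t, ⁅z 0, z 1⁆⁆⁆ = 0
  right : ⁅⁅z 2, ⁅z 1, t⁆⁆, ⁅t, ⁅z 0, z 1⁆⁆⁆ = 0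
  long : ∀ m, ⁅⁅z 0, seg z 1 m⁆, ⁅t, seg z 1 m⁆⁆ = 0

/-- The root elements of type `ε + ε` attached to a fork. -/
def bent (z : ℕ → L) (t : L) (i : ℕ) : ℕ → L
  | 0 => seg (Function.update z 0 t) 0 i
  | q + 1 => ⁅z q, bent z t i q⁆

lemma seg_congr {z w : ℕ → L} (q d : ℕ) (h : ∀ k, q ≤ k → z k = w k) : seg z q d = seg w q d := by
  induction d with
  | zero => exact h _ le_rfl
  | succ d ih => rw [seg, seg, ih, h _ (by omega)]

/-! ### Brackets of generators with the elements of weight `ε + ε` -/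

namespace IsFork
variable {z : ℕ → L} {t : L} (hz : IsFork z t)

include hz in
lemma lie_bent_of_gt (k i q : ℕ) (hq : q ≤ i) (h : i + 2 ≤ k) : ⁅z k, bent z t i q⁆ = 0 := by
  induction q with
  | zero => simpa [bent, show k ≠ 0 by omega] using hz.chain'.lie_seg_of_gt k 0 i (by omega)
  | succ q ih => exact lie_lie_eq_zero (hz.chain.far' _ _ (by omega)) (ih (by omega))

lemma lie_bent_top (hz : IsFork z t) (i q : ℕ) (hq : q ≤ i) :
    ⁅z (i + 1), bent z t i q⁆ = bent z t (i + 1) q := by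
  induction q with
  | zero => simp [bent, seg]
  | succ q ih =>
    rw [bent, lie_lie_left_comm (hz.chain.far' _ _ (by omega)), ih (by omega), bent]

include hz in
lemma lie_bent_mid (k i q : ℕ) (hq : q < k) (h : k ≤ i) : ⁅z k, bent z t i q⁆ = 0 := by
  induction q with
  | zero =>
    simpa [bent, show k ≠ 0 by omega] using hz.chain'.lie_seg_mid hz.two k 0 i (by omega) (by omega)
  | succ q ih => exact lie_lie_eq_zero (hz.chain.far' _ _ (by omega)) (ih (by omega))

-- The index `k = 0` is separate because `z 0` is replaced by `t` in the updated chain; there `ends`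
-- starts the induction.
include hz in
lemma sq_lie_seg' (k d : ℕ) : ⁅z k, ⁅z k, seg (Function.update z 0 t) 0 d⁆⁆ = 0 := by
  rcases Nat.eq_zero_or_pos k with rfl | hk
  · induction d with
    | zero => simp [seg, hz.ends]
    | succ d ih =>
      refine sq_lie_eq_zero hz.two ?_ ih
      simpa using hz.chain.sq_lie 0 (0 + d + 1)
  · simpa [hk.ne'] using hz.chain'.sq_lie_seg hz.two k 0 d

include hz in
lemma sq_lie_bent (k i q : ℕ) : ⁅z k, ⁅z k, bent z t i q⁆⁆ = 0 := by
  induction q with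
  | zero => exact hz.sq_lie_seg' k i
  | succ q ih => exact sq_lie_eq_zero hz.two (hz.chain.sq_lie _ _) ih

lemma bent_two_zero : bent z t 2 0 = ⁅z 2, ⁅z 1, t⁆⁆ := by simp [bent, seg]

-- Since `t` commutes with `z k` for `k ≥ 2`, only `i = 2` matters, and that case is the relation
-- `right` after regrouping with the Leibniz rule.
include hz in
lemma lie_end_bent_two (i : ℕ) (hi : 2 ≤ i) : ⁅t, bent z t i 2⁆ = 0 := by
  induction i, hi using Nat.le_induction with
  | base =>
    have h0 : ⁅t, bent z t 2 0⁆ = 0 := by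
      simpa [bent] using hz.chain'.lie_seg_mid hz.two 0 0 2 (by omega) (by omega)
    have h1 := hz.lie_bent_mid 1 2 0 (by omega) (by omega)
    rw [bent, bent, leibniz_lie (z 1), h1, lie_zero, add_zero, leibniz_lie t, h0, lie_zero,
      add_zero, lie_comm_of_two hz.two (z 1), bent_two_zero, lie_eq_zero_swap hz.right]
  | succ i hi ih =>
    rw [← hz.lie_bent_top _ _ hi]
    refine lie_lie_eq_zero ?_ ih
    simpa using hz.chain'.far 0 (i + 1) (by omega)

-- The counterpart of `lie_end_bent_two` for the other end of the fork; the case `i = 2` is the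
-- relation `left`.
include hz in
lemma lie_zero_bent_two (i : ℕ) (hi : 2 ≤ i) : ⁅z 0, bent z t i 2⁆ = 0 := by
  induction i, hi using Nat.le_induction with
  | base =>
    have h0 := hz.chain.lie_seg_mid hz.two 0 0 2 (by omega) (by omega)
    have h1 := hz.chain.lie_seg_mid hz.two 1 0 2 (by omega) (by omega)
    have ht : ⁅t, z 2⁆ = 0 := by simpa using hz.chain'.far 0 2 (by omega)
    -- The two ends can be exchanged: the same element is built from the segment through `z 0`, with
    -- `t` applied last.
    have e : bent z t 2 1 = ⁅t, seg z 0 2⁆ := by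
      rw [bent, bent_two_zero]
      simp only [seg, zero_add]
      rw [lie_lie_left_comm (hz.chain.far 0 2 (by omega)), lie_lie_left_comm ht,
        lie_comm_of_two hz.two (z 1) t, lie_lie_left_comm hz.ends,
        lie_comm_of_two hz.two (z 0) (z 1)]
    rw [bent, e, leibniz_lie (z 1), h1, lie_zero, add_zero, leibniz_lie (z 0), h0, lie_zero,
      add_zero, lie_comm_of_two hz.two (z 1), lie_lie_left_comm hz.ends]
    exact lie_eq_zero_swap hz.left
  | succ i hi ih =>
    rw [← hz.lie_bent_top _ _ hi]
    exact lie_lie_eq_zero (hz.chain.far _ _ (by omega)) ih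

-- For `k = q - 1` the generator acts twice. For `k = q - 2` the claim reduces to `triple`, except
-- that `k = 0` has no lower neighbour in the chain and needs the relation `left`. For smaller `k`
-- the outer factor commutes with `z k`.
include hz in
lemma lie_bent_of_lt (k i q : ℕ) (hq : q ≤ i) (h : k < q) : ⁅z k, bent z t i q⁆ = 0 := by
  obtain rfl | h' := (Nat.succ_le_of_lt h).eq_or_lt
  · exact hz.sq_lie_bent _ _ _
  clear h
  induction q, h' using Nat.le_induction with
  | base =>
    cases k with
    | zero => exact hz.lie_zero_bent_two _ hq
    | succ k =>
      simp only [Nat.succ_eq_add_one] at hq ⊢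
      rw [bent, bent, bent, triple_lie (hz.lie_bent_mid _ _ _ (by omega) (by omega))
        (hz.lie_bent_mid _ _ _ (by omega) (by omega)), hz.chain.triple, zero_lie]
  | succ q hkq ih =>
    simp only [Nat.succ_eq_add_one] at hkq
    exact lie_lie_eq_zero (hz.chain.far _ _ (by omega)) (ih (by omega))

include hz in
lemma lie_end_seg_one (d : ℕ) : ⁅t, seg z 1 d⁆ = bent z t (d + 1) 0 := by
  have h := hz.chain'.lie_seg_bot 0 d hz.two
  rw [zero_add, Function.update_self] at h
  rw [bent, ← h, seg_congr (w := Function.update z 0 t)]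
  intro k hk
  simp [show k ≠ 0 by omega]

-- Collects the factors `z 1, …, z (j + 1)` of a bent word into one segment, possible because those
-- of index at least `2` annihilate `bent z t i 1`. This brings `lie_bent_diag` into the shape of
-- the relations `long`.
include hz in
lemma lie_seg_bent_one (i j : ℕ) (h : j + 2 ≤ i) :
    ⁅seg z 1 j, bent z t i 1⁆ = bent z t i (j + 2) := by
  induction j with
  | zero => rfl
  | succ j ih =>
    rw [seg, lie_lie, ih (by omega), hz.lie_bent_mid (1 + j + 1) i 1 (by omega) (by omega),
      lie_zero, sub_zero, show 1 + j + 1 = j + 2 by omega]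
    rfl

-- The weight is `2ε_{i+1}`, which is not a root of type `D`. Successive Leibniz regroupings turn
-- the bracket into `⁅⁅z 0, s⁆, ⁅t, s⁆⁆` with `s = seg z 1 (i - 1)`, for `i ≥ 2`; this is where
-- relations (d) enter.
include hz in
lemma lie_bent_diag (i : ℕ) : ⁅z i, bent z t i i⁆ = 0 := by
  match i with
  | 0 => simpa [bent, seg] using hz.ends
  | 1 =>
    rw [bent, bent, leibniz_lie]
    have h1 := hz.chain'.serre' 0
    have h2 := hz.fork
    simp only [seg, zero_add, Function.update_self, ne_eq, one_ne_zero, not_false_eq_true,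
      Function.update_of_ne] at h1 ⊢
    rw [h1, h2, lie_zero, add_zero]
  | i + 2 =>
    have hc : ⁅seg z 1 (i + 1), bent z t (i + 2) 0⁆ = 0 := by
      rw [seg_congr (w := Function.update z 0 t)]
      · exact hz.chain'.lie_seg_seg hz.two 1 (i + 1) (i + 2) (by omega) (by omega)
      · intro k hk
        simp [show k ≠ 0 by omega]
    rw [← hz.lie_seg_bent_one _ _ le_rfl, leibniz_lie,
      hz.lie_bent_mid (i + 2) _ _ (by omega) (by omega), lie_zero, add_zero,
      show i + 2 = 1 + i + 1 by omega, ← seg, show 1 + i + 1 = i + 2 by omega, bent, leibniz_lie,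
      hc, lie_zero, add_zero, lie_comm_of_two hz.two _ (z 0), ← hz.lie_end_seg_one, hz.long]

lemma lie_end_bent (hz : IsFork z t) (i q : ℕ) (hq : q ≤ i) : ⁅t, bent z t i q⁆ = 0 := by
  match q with
  | 0 => simpa [bent] using hz.chain'.lie_seg_mid hz.two 0 0 i (by omega) (by omega)
  | 1 => exact lie_lie_eq_zero (lie_eq_zero_swap hz.ends) (hz.lie_end_bent i 0 (by omega))
  | 2 => exact hz.lie_end_bent_two i hq
  | q + 3 =>
    refine lie_lie_eq_zero ?_ (hz.lie_end_bent i (q + 2) (by omega))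
    simpa using hz.chain'.far 0 (q + 2) (by omega)

end IsFork
end
-- Translation between the relations of the theorem and forks
section
variable {n : ℕ} {K : Type*} [Field K]

/-- Adjacency in the Dynkin diagram `D n`, with nodes numbered from `1`. -/
def DynkinAdj (n a b : ℕ) : Prop :=
  (a + 1 = b ∧ b < n) ∨ (b + 1 = a ∧ a < n) ∨ (a + 2 = n ∧ b = n) ∨ (b + 2 = n ∧ a = n)

lemma cartan_eq_zero_iff (hn : 4 ≤ n) (i j : Fin n) (hij : i ≠ j) :
    cartan n K i j = 0 ↔ ¬ DynkinAdj n (i + 1) (j + 1) := by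
  have hij' : i.val ≠ j.val := fun h => hij (Fin.ext h)
  simp only [cartan, Matrix.map_apply, CartanMatrix.D, Matrix.of_apply, DynkinAdj]
  have hi := i.2
  have hj := j.2
  split_ifs with h1
  all_goals first
    | exact absurd h1 hij
    | (exfalso; omega)
    | (simp only [Int.cast_neg, Int.cast_one, neg_eq_zero, one_ne_zero, false_iff, not_not]; omega)
    | (simp only [Int.cast_zero, true_iff]; omega)

lemma X_of_mem {k : ℕ} (h1 : 1 ≤ k) (h2 : k ≤ n) :
    X n K k = FreeLieAlgebra.of K ⟨k - 1, by omega⟩ := dif_pos ⟨h1, h2⟩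

@[simp] lemma X_zero : X n K 0 = 0 := dif_neg (by omega)

lemma X_succ (i : Fin n) : X n K (i + 1) = FreeLieAlgebra.of K i := by
  rw [X_of_mem (by omega) (by omega)]; rfl

lemma lie_X_mem_serre (hn : 4 ≤ n) {a b : ℕ} (ha : 1 ≤ a) (ha' : a ≤ n) (hb : 1 ≤ b) (hb' : b ≤ n)
    (hab : a ≠ b) (h : ¬ DynkinAdj n a b) : ⁅X n K a, X n K b⁆ ∈ serreRelations n K := by
  obtain ⟨a, rfl⟩ : ∃ i, a = i + 1 := ⟨a - 1, by omega⟩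
  obtain ⟨b, rfl⟩ : ∃ i, b = i + 1 := ⟨b - 1, by omega⟩
  have hne : (⟨a, ha'⟩ : Fin n) ≠ ⟨b, hb'⟩ := by simpa using hab
  refine ⟨⟨a, ha'⟩, ⟨b, hb'⟩, hne, ?_⟩
  rw [serreB, if_pos ((cartan_eq_zero_iff hn _ _ hne).2 h), pow_one, ← X_succ, ← X_succ]
  rfl

lemma lie_lie_X_mem_serre (hn : 4 ≤ n) {a b : ℕ} (ha : 1 ≤ a) (ha' : a ≤ n) (hb : 1 ≤ b)
    (hb' : b ≤ n) (hab : a ≠ b) (h : DynkinAdj n a b) :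
    ⁅X n K a, ⁅X n K a, X n K b⁆⁆ ∈ serreRelations n K := by
  obtain ⟨a, rfl⟩ : ∃ i, a = i + 1 := ⟨a - 1, by omega⟩
  obtain ⟨b, rfl⟩ : ∃ i, b = i + 1 := ⟨b - 1, by omega⟩
  have hne : (⟨a, ha'⟩ : Fin n) ≠ ⟨b, hb'⟩ := by simpa using hab
  refine ⟨⟨a, ha'⟩, ⟨b, hb'⟩, hne, ?_⟩
  rw [serreB, if_neg (fun h' => (cartan_eq_zero_iff hn _ _ hne).1 h' h), pow_two, ← X_succ,
    ← X_succ]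
  rfl

variable {L : Type*} [LieRing L] [LieAlgebra K L]

/-- The images of the generators along the chain `x_{n-1}, x_{n-2}, …, x_1`, continued by `0`. -/
noncomputable def chainImage (f : FreeLieAlgebra K (Fin n) →ₗ⁅K⁆ L) (k : ℕ) : L :=
  f (X n K (n - 1 - k))

variable (f : FreeLieAlgebra K (Fin n) →ₗ⁅K⁆ L)

lemma chainImage_eq_zero {k : ℕ} (h : n - 1 ≤ k) : chainImage f k = 0 := by
  rw [chainImage, Nat.sub_eq_zero_of_le h, X_zero, map_zero]

lemma map_nested (i m q : ℕ) (h : i + m + q + 1 = n) :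
    f (nested n K i m) = seg (chainImage f) q m := by
  induction m generalizing i with
  | zero => rw [nested, seg, chainImage, show n - 1 - q = i by omega]
  | succ m ih =>
    rw [nested, seg, LieHom.map_lie, ih (i + 1) (by omega), chainImage,
      show n - 1 - (q + m + 1) = i by omega]

lemma add_self_of_charTwo [CharP K 2] (u : L) : u + u = 0 := by
  rw [← two_smul K, CharTwo.two_eq_zero, zero_smul]

lemma chainImage_lie (hn : 4 ≤ n)
    (hf : ∀ r ∈ serreRelations n K, f r = 0) (i b : ℕ) (hb : 1 ≤ b) (hb' : b ≤ n)
    (hb'' : n - 1 - i ≠ b) (h : ¬ DynkinAdj n (n - 1 - i) b) :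
    ⁅chainImage f i, f (X n K b)⁆ = 0 := by
  rcases Nat.lt_or_ge i (n - 1) with hi | hi
  · rw [chainImage, ← LieHom.map_lie]
    exact hf _ (lie_X_mem_serre hn (by omega) (by omega) hb hb' hb'' h)
  · rw [chainImage_eq_zero f hi, zero_lie]

/-- The chain is infinite, but `X n K 0 = 0` makes it vanish from index `n - 1` on, so only indices
inside the diagram need a relation. -/
lemma isChain_chainImage [CharP K 2] (hn : 4 ≤ n)
    (hf : ∀ r ∈ serreRelations n K ∪ nonSerreRelations n K, f r = 0) :
    IsChain (chainImage f) where
  far i j h := by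
    rcases Nat.lt_or_ge j (n - 1) with hj | hj
    · exact chainImage_lie f hn (fun r hr => hf r (.inl hr)) _ _ (by omega) (by omega) (by omega)
        (by unfold DynkinAdj; omega)
    · rw [chainImage_eq_zero f hj, lie_zero]
  serre i := by
    rcases Nat.lt_or_ge (i + 1) (n - 1) with hj | hj
    · simp only [chainImage, ← LieHom.map_lie]
      exact hf _ (.inl (lie_lie_X_mem_serre hn (by omega) (by omega) (by omega) (by omega)
        (by omega) (by unfold DynkinAdj; omega)))
    · rw [chainImage_eq_zero f hj, lie_zero, lie_zero]
  serre' i := by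
    rcases Nat.lt_or_ge (i + 1) (n - 1) with hj | hj
    · simp only [chainImage, ← LieHom.map_lie]
      exact hf _ (.inl (lie_lie_X_mem_serre hn (by omega) (by omega) (by omega) (by omega)
        (by omega) (by unfold DynkinAdj; omega)))
    · rw [chainImage_eq_zero f hj, zero_lie]
  mid i := by
    rcases Nat.lt_or_ge (i + 2) (n - 1) with hj | hj
    · simp only [chainImage, ← LieHom.map_lie]
      -- Reversal sends the middle index `i + 1` of the chain to the node `n - 1 - (i + 1)` of the
      -- diagram.
      refine hf _ (.inr (.inl (.inl ⟨n - 1 - (i + 1), by omega, by omega, ?_⟩)))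
      rw [show n - 1 - (i + 1) - 1 = n - 1 - (i + 2) by omega,
        show n - 1 - (i + 1) + 1 = n - 1 - i by omega]
    · rw [chainImage_eq_zero f hj, zero_lie, zero_lie]

lemma isFork_of_relations [CharP K 2] (hn : 4 ≤ n)
    (hf : ∀ r ∈ serreRelations n K ∪ nonSerreRelations n K, f r = 0) :
    IsFork (chainImage f) (f (X n K n)) := by
  have hc := isChain_chainImage f hn hf
  have hfour : ∀ r ∈ _, f r = 0 := fun r hr => hf r (.inr (.inl (.inr hr)))
  have h0 : chainImage f 0 = f (X n K (n - 1)) := rfl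
  have h1 : chainImage f 1 = f (X n K (n - 2)) := rfl
  have h2 : chainImage f 2 = f (X n K (n - 3)) := rfl
  have two : ∀ u : L, u + u = 0 := add_self_of_charTwo (K := K)
  have hfork : ⁅⁅chainImage f 1, chainImage f 0⁆, ⁅chainImage f 1, f (X n K n)⁆⁆ = 0 := by
    rw [h0, h1]; simp only [← LieHom.map_lie]; exact hfour _ (.inr (.inl rfl))
  have hfar : ∀ i, i ≠ 1 → ⁅chainImage f i, f (X n K n)⁆ = 0 := fun i hi =>
    chainImage_lie f hn (fun r hr => hf r (.inl hr)) _ _ (by omega) (by omega) (by omega)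
      (by unfold DynkinAdj; omega)
  refine ⟨two, hc, ⟨fun i j h => ?_, fun i => ?_, fun i => ?_, fun i => ?_⟩, hfar 0 (by omega),
    hfork, ?_, ?_, fun m => ?_⟩
  · cases i with
    | zero => simpa [show j ≠ 0 by omega] using lie_eq_zero_swap (hfar j (by omega))
    | succ i => simpa [show j ≠ 0 by omega] using hc.far _ _ h
  · cases i with
    | zero =>
      simp only [Function.update_self, zero_add, ne_eq, one_ne_zero, not_false_eq_true,
        Function.update_of_ne, h1, ← LieHom.map_lie]
      exact hf _ (.inl (lie_lie_X_mem_serre hn (by omega) (by omega) (by omega) (by omega)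
        (by omega) (by unfold DynkinAdj; omega)))
    | succ i => simpa using hc.serre (i + 1)
  · cases i with
    | zero =>
      simp only [Function.update_self, zero_add, ne_eq, one_ne_zero, not_false_eq_true,
        Function.update_of_ne, h1, ← LieHom.map_lie]
      exact hf _ (.inl (lie_lie_X_mem_serre hn (by omega) (by omega) (by omega) (by omega)
        (by omega) (by unfold DynkinAdj; omega)))
    | succ i => simpa using hc.serre' (i + 1)
  · cases i with
    | zero =>
      simp only [Function.update_self, zero_add, ne_eq, one_ne_zero, not_false_eq_true,
        Function.update_of_ne, h1, h2, ← LieHom.map_lie, OfNat.ofNat_ne_zero]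
      exact hfour _ (.inl rfl)
    | succ i => simpa using hc.mid (i + 1)
  · rw [h0, h1, h2]; simp only [← LieHom.map_lie]; exact hfour _ (.inr (.inr (.inl rfl)))
  · rw [h0, h1, h2]; simp only [← LieHom.map_lie]; exact hfour _ (.inr (.inr (.inr rfl)))
  -- The case `m = 0` is not in family (d): it is the second relation of (c). For `m ≥ n - 2` the
  -- segment runs past the end of the chain and is zero.
  · rcases Nat.eq_zero_or_pos m with rfl | hm
    · rw [seg, lie_comm_of_two two (chainImage f 0), lie_comm_of_two two (f _)]
      exact hfork
    rcases Nat.lt_or_ge m (n - 2) with hm' | hm'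
    · rw [← map_nested f (n - 2 - m) m 1 (by omega), h0]
      simp only [← LieHom.map_lie]
      refine hf _ (.inr (.inr ⟨n - 2 - m, by omega, by omega, ?_⟩))
      rw [show n - 2 - (n - 2 - m) = m by omega]
    · obtain ⟨m, rfl⟩ : ∃ k, m = k + 1 := ⟨m - 1, by omega⟩
      rw [seg, chainImage_eq_zero f (k := 1 + m + 1) (by omega), zero_lie, lie_zero, zero_lie]

lemma map_X_eq_chainImage {a : ℕ} (h : a < n) : f (X n K a) = chainImage f (n - 1 - a) := by
  rw [chainImage, show n - 1 - (n - 1 - a) = a by omega]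

/-- The converse of `isFork_of_relations`. It allows the relations to be verified on matrices in
fork form. -/
lemma relations_of_isFork (hn : 4 ≤ n) (h : IsFork (chainImage f) (f (X n K n)))
    {r : FreeLieAlgebra K (Fin n)} (hr : r ∈ serreRelations n K ∪ nonSerreRelations n K) :
    f r = 0 := by
  have h0 : f (X n K (n - 1)) = chainImage f 0 := rfl
  have h1 : f (X n K (n - 2)) = chainImage f 1 := rfl
  have h2 : f (X n K (n - 3)) = chainImage f 2 := rfl
  have far : ∀ k, k ≠ 1 → ⁅f (X n K n), chainImage f k⁆ = 0 := fun k hk => by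
    rcases Nat.eq_zero_or_pos k with rfl | hk'
    · exact lie_eq_zero_swap h.ends
    · simpa [hk'.ne'] using h.chain'.far 0 k (by omega)
  rcases hr with ⟨i, j, hij, rfl⟩ | ((⟨i, hi1, hi2, rfl⟩ | hr) | ⟨i, hi1, hi2, rfl⟩)
  · have hij' : i.val ≠ j.val := fun h => hij (Fin.ext h)
    have hi := i.2
    have hj := j.2
    rw [← X_succ, ← X_succ, serreB]
    have adj := cartan_eq_zero_iff (K := K) hn i j hij
    split_ifs with hc
    · have hna := adj.1 hc
      rw [DynkinAdj] at hna
      rw [add_zero, pow_one, LieAlgebra.ad_apply, LieHom.map_lie]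
      rcases eq_or_ne (i.val + 1) n with hi' | hi'
      · rw [hi', map_X_eq_chainImage f (a := j + 1) (by omega)]
        exact far _ (by omega)
      rcases eq_or_ne (j.val + 1) n with hj' | hj'
      · rw [hj', map_X_eq_chainImage f (a := i + 1) (by omega)]
        exact lie_eq_zero_swap (far _ (by omega))
      rw [map_X_eq_chainImage f (a := i + 1) (by omega),
        map_X_eq_chainImage f (a := j + 1) (by omega)]
      rcases Nat.lt_or_ge i j with hlt | hlt
      · exact h.chain.far' _ _ (by omega)
      · exact h.chain.far _ _ (by omega)
    · rw [show 1 + 1 = 2 from rfl, pow_two, Module.End.mul_apply, LieAlgebra.ad_apply,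
        LieAlgebra.ad_apply, LieHom.map_lie, LieHom.map_lie]
      rcases eq_or_ne (i.val + 1) n with hi' | hi'
      · rw [hi', map_X_eq_chainImage f (a := j + 1) (by omega)]
        rcases Nat.eq_zero_or_pos (n - 1 - (j + 1)) with hk | hk
        · rw [hk, far 0 (by omega), lie_zero]
        · simpa [hk.ne'] using h.chain'.sq_lie 0 (n - 1 - (j + 1))
      rcases eq_or_ne (j.val + 1) n with hj' | hj'
      · rw [hj', map_X_eq_chainImage f (a := i + 1) (by omega)]
        simpa [seg] using h.sq_lie_seg' (n - 1 - (i + 1)) 0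
      rw [map_X_eq_chainImage f (a := i + 1) (by omega),
        map_X_eq_chainImage f (a := j + 1) (by omega)]
      exact h.chain.sq_lie _ _
  · simp only [LieHom.map_lie]
    have := h.chain.mid (n - 1 - (i + 1))
    simp only [chainImage] at this
    rwa [show n - 1 - (n - 1 - (i + 1) + 2) = i - 1 by omega,
      show n - 1 - (n - 1 - (i + 1) + 1) = i by omega,
      show n - 1 - (n - 1 - (i + 1)) = i + 1 by omega] at this
  · rcases hr with rfl | rfl | rfl | rfl <;> simp only [LieHom.map_lie, h0, h1, h2]
    · simpa using h.chain'.mid 0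
    · exact h.fork
    · exact h.left
    · exact h.right
  · simp only [LieHom.map_lie]
    rw [map_nested f i (n - 2 - i) 1 (by omega)]
    exact h.long _

end
-- Spanning by root elements
section
variable {K : Type*} [Field K] {L : Type*} [LieRing L] [LieAlgebra K L]

/-- A subspace that contains a set of Lie generators and is stable under bracketing with them
is the whole Lie algebra. -/
lemma eq_top_of_lie_mem {G : Set L} (hG : LieSubalgebra.lieSpan K L G = ⊤) (S : Submodule K L)
    (h1 : G ⊆ S) (h2 : ∀ g ∈ G, ∀ s ∈ S, ⁅g, s⁆ ∈ S) : S = ⊤ := by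
  -- The stabilizer of `S` is a subalgebra by the Jacobi identity. It contains the generators, hence
  -- everything, so `S` is itself a subalgebra containing them.
  let N : LieSubalgebra K L :=
    { carrier := {y | ∀ s ∈ S, ⁅y, s⁆ ∈ S}
      add_mem' := fun ha hb s hs => by rw [add_lie]; exact S.add_mem (ha s hs) (hb s hs)
      zero_mem' := fun s _ => by rw [zero_lie]; exact S.zero_mem
      smul_mem' := fun c y hy s hs => by rw [smul_lie]; exact S.smul_mem _ (hy s hs)
      lie_mem' := fun ha hb s hs => by
        rw [lie_lie]
        exact S.sub_mem (ha _ (hb s hs)) (hb _ (ha s hs)) }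
  have hN : ∀ y, y ∈ N := fun y => by
    have : LieSubalgebra.lieSpan K L G ≤ N := LieSubalgebra.lieSpan_le.2 h2
    exact this (by rw [hG]; trivial)
  let S' : LieSubalgebra K L := { S with lie_mem' := fun {a b} _ hb => hN a b hb }
  have hS : LieSubalgebra.lieSpan K L G ≤ S' := LieSubalgebra.lieSpan_le.2 h1
  rw [hG] at hS
  exact eq_top_iff.2 fun y _ => hS (by trivial)

/-- The root elements attached to a fork. -/
inductive IsRootElement (z : ℕ → L) (t : L) : L → Prop
  | seg (q d : ℕ) : IsRootElement z t (seg z q d)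
  | bent (i q : ℕ) (h : q ≤ i) : IsRootElement z t (bent z t i q)

namespace IsFork

variable {z : ℕ → L} {t : L} (hz : IsFork z t)

-- Adding a simple root to a positive root gives a positive root or no root. No scalars appear: the
-- signs `±1` disappear in characteristic 2.
include hz in
lemma lie_chain_rootElement (k : ℕ) {u : L} (hu : IsRootElement z t u) :
    ⁅z k, u⁆ = 0 ∨ IsRootElement z t ⁅z k, u⁆ := by
  cases hu with
  | seg q d =>
    rcases Nat.lt_or_ge k q with h | h
    · obtain rfl | h := (Nat.succ_le_of_lt h).eq_or_lt
      · exact .inr (by rw [hz.chain.lie_seg_bot _ _ hz.two]; exact .seg _ _)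
      · exact .inl (hz.chain.lie_seg_of_lt _ _ _ h)
    rcases Nat.lt_or_ge (q + d) k with h' | h'
    · obtain rfl | h' := (Nat.succ_le_of_lt h').eq_or_lt
      · exact .inr (.seg q (d + 1))
      · exact .inl (hz.chain.lie_seg_of_gt _ _ _ h')
    · exact .inl (hz.chain.lie_seg_mid hz.two _ _ _ h h')
  | bent i q hq =>
    rcases lt_trichotomy k q with h | rfl | h
    · exact .inl (hz.lie_bent_of_lt _ _ _ hq h)
    · obtain rfl | h' := hq.eq_or_lt
      · exact .inl (hz.lie_bent_diag _)
      · exact .inr (.bent i (k + 1) h')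
    rcases Nat.lt_or_ge i k with h' | h'
    · obtain rfl | h' := (Nat.succ_le_of_lt h').eq_or_lt
      · exact .inr (by rw [Nat.succ_eq_add_one, hz.lie_bent_top _ _ hq]; exact .bent _ _ (by omega))
      · exact .inl (hz.lie_bent_of_gt _ _ _ hq h')
    · exact .inl (hz.lie_bent_mid _ _ _ h h')

include hz in
lemma lie_end_rootElement {u : L} (hu : IsRootElement z t u) :
    ⁅t, u⁆ = 0 ∨ IsRootElement z t ⁅t, u⁆ := by
  have ht : ∀ k, k ≠ 1 → ⁅t, z k⁆ = 0 := fun k hk => by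
    rcases Nat.eq_zero_or_pos k with rfl | hk'
    · exact lie_eq_zero_swap hz.ends
    · simpa [hk'.ne'] using hz.chain'.far 0 k (by omega)
  cases hu with
  | seg q d =>
    match q with
    | 0 =>
      cases d with
      | zero => exact .inl (ht 0 (by omega))
      | succ d =>
        rw [← hz.chain.lie_seg_bot _ _ hz.two, lie_lie_left_comm (ht 0 (by omega)),
          hz.lie_end_seg_one]
        exact .inr (.bent (d + 1) 1 (by omega))
    | 1 => exact .inr (by rw [hz.lie_end_seg_one]; exact .bent _ _ (by omega))
    | q + 2 =>
      left
      induction d with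
      | zero => exact ht _ (by omega)
      | succ d ih => exact lie_lie_eq_zero (ht _ (by omega)) ih
  | bent i q hq => exact .inl (hz.lie_end_bent _ _ hq)

include hz in
lemma span_rootElement
    (hgen : LieSubalgebra.lieSpan K L (insert t (Set.range z)) = ⊤) :
    Submodule.span K {u | IsRootElement z t u} = ⊤ := by
  refine eq_top_of_lie_mem hgen _ ?_ ?_
  · rintro _ (rfl | ⟨k, rfl⟩)
    · exact Submodule.subset_span
        (by simpa [bent, seg] using IsRootElement.bent (z := z) 0 0 le_rfl)
    · exact Submodule.subset_span (.seg k 0)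
  · intro g hg s hs
    induction hs using Submodule.span_induction with
    | mem u hu =>
      have : ⁅g, u⁆ = 0 ∨ IsRootElement z t ⁅g, u⁆ := by
        rcases hg with rfl | ⟨k, rfl⟩
        · exact hz.lie_end_rootElement hu
        · exact hz.lie_chain_rootElement k hu
      rcases this with h | h
      · rw [h]; exact Submodule.zero_mem _
      · exact Submodule.subset_span h
    | zero => rw [lie_zero]; exact Submodule.zero_mem _
    | add u v _ _ hu hv => rw [lie_add]; exact Submodule.add_mem _ hu hv
    | smul c u _ hu => rw [lie_smul]; exact Submodule.smul_mem _ c hu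

end IsFork

/-- The universal property maps the free algebra into the subalgebra; followed by the inclusion this
is the identity. -/
lemma lieSpan_range_of {ι : Type*} :
    LieSubalgebra.lieSpan K (FreeLieAlgebra K ι) (Set.range (FreeLieAlgebra.of K)) = ⊤ := by
  let S := LieSubalgebra.lieSpan K (FreeLieAlgebra K ι) (Set.range (FreeLieAlgebra.of K))
  let g : FreeLieAlgebra K ι →ₗ⁅K⁆ S := FreeLieAlgebra.lift K fun i =>
    ⟨FreeLieAlgebra.of K i, LieSubalgebra.subset_lieSpan ⟨i, rfl⟩⟩
  have h : S.incl.comp g = LieHom.id := by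
    ext i
    simp [g]
  refine eq_top_iff.2 fun y _ => ?_
  have hy : S.incl (g y) = y := congrArg (fun f : FreeLieAlgebra K ι →ₗ⁅K⁆ _ => f y) h
  rw [← hy]
  exact (g y).2

end

attribute [local instance] LieRing.ofAssociativeRing

open Matrix

/-! ### Root matrices and their commutators -/

section
variable {n : ℕ} {K : Type*} [Field K]

variable (n K) in
/-- The matrix unit at position `(p, q)`, with rows and columns numbered from the end
and starting at `0`; it vanishes if `p` or `q` is out of range. -/
def revUnit (p q : ℕ) : Matrix (Fin n) (Fin n) K :=
  of fun i j => if i.val + p + 1 = n ∧ j.val + q + 1 = n then 1 else 0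

lemma revUnit_eq_zero {p q : ℕ} (h : n ≤ p ∨ n ≤ q) : revUnit n K p q = 0 := by
  ext i j
  simp only [revUnit, of_apply, Matrix.zero_apply, ite_eq_right_iff]
  omega

lemma revUnit_eq_single (i j : Fin n) :
    revUnit n K (n - 1 - i) (n - 1 - j) = single i j 1 := by
  ext a b
  simp only [revUnit, of_apply, single_apply, Fin.ext_iff]
  congr 1
  simp only [eq_iff_iff]
  omega

/-- The order hypothesis matters only out of range: if `q = r ≥ n` the left side is zero, and `q <
p` or `r < s` forces `revUnit n K p s` to be zero as well. -/
lemma revUnit_mul (p q r s : ℕ) (h : q < p ∨ r < s) :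
    revUnit n K p q * revUnit n K r s = if q = r then revUnit n K p s else 0 := by
  rcases Nat.lt_or_ge q n with hq | hq
  · ext i j
    rw [Matrix.mul_apply, Finset.sum_eq_single ⟨n - 1 - q, by omega⟩]
    · split_ifs with hqr
      · subst hqr
        simp only [revUnit, of_apply]
        have e1 : n - 1 - q + q + 1 = n := by omega
        simp only [e1, and_true, true_and, mul_ite, mul_one, mul_zero, ite_and]
        split_ifs <;> rfl
      · have : ¬ (n - 1 - q + r + 1 = n) := by omega
        simp [revUnit, this]
    · intro k _ hk
      have : ¬ (k.val + q + 1 = n) := fun h => hk (Fin.ext (by simp only; omega))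
      simp [revUnit, this]
    · simp
  · rw [revUnit_eq_zero (.inr hq), zero_mul]
    split_ifs with hqr
    · rw [revUnit_eq_zero (by omega)]
    · rfl

variable (n K) in
/-- The root matrix of weight `ε_p - ε_q` (reversed numbering). -/
def rootA (p q : ℕ) : Matrix (Fin n ⊕ Fin n) (Fin n ⊕ Fin n) K :=
  fromBlocks (revUnit n K p q) 0 0 (revUnit n K q p)

variable (n K) in
/-- The root matrix of weight `ε_p + ε_q` (reversed numbering). -/
def rootB (p q : ℕ) : Matrix (Fin n ⊕ Fin n) (Fin n ⊕ Fin n) K :=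
  fromBlocks 0 (revUnit n K p q + revUnit n K q p) 0 0

lemma rootB_comm (p q : ℕ) : rootB n K p q = rootB n K q p := by
  rw [rootB, rootB, add_comm]

@[simp] lemma rootB_self [CharP K 2] (p : ℕ) : rootB n K p p = 0 := by
  rw [rootB, add_self_of_charTwo (K := K), fromBlocks_zero]

lemma lie_rootA_rootA [CharP K 2] {p q r s : ℕ} (h : q < p) (h' : s < r) :
    ⁅rootA n K p q, rootA n K r s⁆ =
      (if q = r then rootA n K p s else 0) + (if s = p then rootA n K r q else 0) := by
  rw [rootA, rootA, bracket_fromBlocks]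
  simp only [mul_zero, zero_mul, add_zero, sub_zero, zero_add]
  rw [revUnit_mul p q r s (.inl h), revUnit_mul r s p q (.inl h'), revUnit_mul q p s r (by omega),
    revUnit_mul s r q p (by omega), sub_eq_add_of_charTwo, sub_eq_add_of_charTwo]
  simp only [rootA, eq_comm (a := p) (b := s), eq_comm (a := r) (b := q)]
  split_ifs <;> simp [fromBlocks_add, add_comm]

lemma lie_rootA_rootB [CharP K 2] {p q r s : ℕ} (h : q < p) :
    ⁅rootA n K p q, rootB n K r s⁆ =
      (if q = r then rootB n K p s else 0) + (if q = s then rootB n K p r else 0) := by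
  rw [rootA, rootB, bracket_fromBlocks]
  simp only [mul_zero, zero_mul, add_zero, sub_zero, zero_add, mul_add, add_mul]
  rw [revUnit_mul p q r s (.inl h), revUnit_mul p q s r (.inl h), revUnit_mul r s q p (.inr h),
    revUnit_mul s r q p (.inr h), sub_eq_add_of_charTwo]
  simp only [rootB, eq_comm (a := r) (b := q), eq_comm (a := s) (b := q)]
  split_ifs <;> simp [fromBlocks_add]
  all_goals abel

lemma lie_rootB_rootB (p q r s : ℕ) : ⁅rootB n K p q, rootB n K r s⁆ = 0 := by
  rw [rootB, rootB, bracket_fromBlocks]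
  simp

lemma rootA_eq_zero {p q : ℕ} (h : n ≤ p) : rootA n K p q = 0 := by
  rw [rootA, revUnit_eq_zero (.inl h), revUnit_eq_zero (.inr h), fromBlocks_zero]

/-- The pairs of indices of the positive roots of one kind. -/
abbrev RootIndex (n : ℕ) : Type := {x : Fin n × Fin n // x.2 < x.1}

variable (n K) in
/-- The root matrices. -/
def rootMat : RootIndex n ⊕ RootIndex n → Matrix (Fin n ⊕ Fin n) (Fin n ⊕ Fin n) K :=
  Sum.elim (fun x => rootA n K x.1.1 x.1.2) (fun x => rootB n K x.1.1 x.1.2)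

/-- Each root `y` has a matrix entry at which its own root matrix is `1` and all others vanish;
these entries serve as dual coordinates. -/
lemma rootMat_apply (x y : RootIndex n ⊕ RootIndex n) :
    rootMat n K x (Sum.inl (y.elim (·.1.1.rev) (·.1.1.rev)))
      (y.elim (Sum.inl ·.1.2.rev) (Sum.inr ·.1.2.rev)) = if x = y then 1 else 0 := by
  obtain ⟨⟨⟨p, hp⟩, ⟨q, hq⟩⟩, hx⟩ | ⟨⟨⟨p, hp⟩, ⟨q, hq⟩⟩, hx⟩ := x <;>
  obtain ⟨⟨⟨r, hr⟩, ⟨s, hs⟩⟩, hy⟩ | ⟨⟨⟨r, hr⟩, ⟨s, hs⟩⟩, hy⟩ := y <;>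
  simp only [Fin.mk_lt_mk] at hx hy <;>
  simp [rootMat, rootA, rootB, revUnit]
  · congr 1
    simp only [eq_iff_iff]
    omega
  · have e1 : ¬ (n - (r + 1) + q + 1 = n ∧ n - (s + 1) + p + 1 = n) := by omega
    rw [if_neg e1, add_zero]
    congr 1
    simp only [eq_iff_iff]
    omega

/-- The root matrices are linearly independent. -/
lemma eq_zero_of_sum_rootMat_eq_zero {g : RootIndex n ⊕ RootIndex n → K}
    (hg : ∑ x, g x • rootMat n K x = 0) (y : RootIndex n ⊕ RootIndex n) : g y = 0 := by
  have := congrFun (congrFun hg (Sum.inl (y.elim (·.1.1.rev) (·.1.1.rev))))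
    (y.elim (Sum.inl ·.1.2.rev) (Sum.inr ·.1.2.rev))
  simpa only [Matrix.sum_apply, Matrix.smul_apply, rootMat_apply, smul_eq_mul, mul_ite, mul_one,
    mul_zero, Finset.sum_ite_eq', Finset.mem_univ, if_true, Matrix.zero_apply] using this

lemma seg_rootA [CharP K 2] (q d : ℕ) :
    seg (fun k => rootA n K (k + 1) k) q d = rootA n K (q + d + 1) q := by
  induction d with
  | zero => rfl
  | succ d ih =>
    rw [seg, ih, lie_rootA_rootA (by omega) (by omega), if_pos rfl, if_neg (by omega), add_zero]
    rfl

lemma seg_update_rootA [CharP K 2] (d : ℕ) :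
    seg (Function.update (fun k => rootA n K (k + 1) k) 0 (rootB n K 1 0)) 0 d =
      rootB n K (d + 1) 0 := by
  induction d with
  | zero => simp [seg]
  | succ d ih =>
    rw [seg, ih, Function.update_of_ne (by omega), lie_rootA_rootB (by omega), if_pos (by omega),
      if_neg (by omega), add_zero, zero_add]

lemma bent_root [CharP K 2] (i q : ℕ) (h : q ≤ i) :
    bent (fun k => rootA n K (k + 1) k) (rootB n K 1 0) i q = rootB n K (i + 1) q := by
  induction q with
  | zero => exact seg_update_rootA i
  | succ q ih =>
    rw [bent, ih (by omega), lie_rootA_rootB (by omega), if_neg (by omega), if_pos rfl, zero_add,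
      rootB_comm]

lemma isChain_rootA [CharP K 2] : IsChain fun k => rootA n K (k + 1) k where
  far i j h := by simp (disch := omega) only [lie_rootA_rootA, if_neg, add_zero]
  serre i := by simp (disch := omega) [lie_rootA_rootA, if_neg]
  serre' i := by simp (disch := omega) [lie_rootA_rootA, if_neg]
  mid i := by simp (disch := omega) [lie_rootA_rootA, if_neg]

lemma isChain_update_rootA [CharP K 2] :
    IsChain (Function.update (fun k => rootA n K (k + 1) k) 0 (rootB n K 1 0)) where
  far i j h := by
    rcases Nat.eq_zero_or_pos i with rfl | hi
    · rw [Function.update_self, Function.update_of_ne (by omega)]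
      apply lie_eq_zero_swap
      simp (disch := omega) only [lie_rootA_rootB, if_neg, add_zero]
    · rw [Function.update_of_ne hi.ne', Function.update_of_ne (by omega)]
      exact isChain_rootA.far i j h
  serre i := by
    cases i with
    | zero =>
      simp only [Function.update_self, zero_add, ne_eq, one_ne_zero, not_false_eq_true,
        Function.update_of_ne]
      rw [lie_comm_of_two (add_self_of_charTwo (K := K)) (rootB n K 1 0) (rootA n K _ _)]
      simp [lie_rootA_rootB, lie_rootB_rootB]
    | succ i => simpa using isChain_rootA.serre (i + 1)
  serre' i := by
    cases i with
    | zero => simp [lie_rootA_rootB]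
    | succ i => simpa using isChain_rootA.serre' (i + 1)
  mid i := by
    cases i with
    | zero => simp (disch := omega) [lie_rootA_rootA, lie_rootA_rootB]
    | succ i => simpa using isChain_rootA.mid (i + 1)

/-- The brackets of weight `2ε_p` (`ends`, `fork`, `long`) come out as `rootB n K p p`, which is
zero in characteristic 2; the other brackets vanish because no indices match. -/
lemma isFork_root [CharP K 2] : IsFork (fun k => rootA n K (k + 1) k) (rootB n K 1 0) where
  two := add_self_of_charTwo (K := K)
  chain := isChain_rootA
  chain' := isChain_update_rootA
  ends := by simp [lie_rootA_rootB]
  fork := by simp (disch := omega) [lie_rootA_rootA, lie_rootA_rootB]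
  left := by
    rw [lie_comm_of_two (add_self_of_charTwo (K := K)) (rootB n K 1 0)]
    simp (disch := omega) [lie_rootA_rootA, lie_rootA_rootB]
  right := by
    rw [lie_comm_of_two (add_self_of_charTwo (K := K)) (rootB n K 1 0)]
    simp (disch := omega) [lie_rootA_rootA, lie_rootA_rootB, lie_rootB_rootB]
  long m := by
    rw [seg_rootA, lie_comm_of_two (add_self_of_charTwo (K := K)) (rootB n K 1 0)]
    simp (disch := omega) [lie_rootA_rootA, lie_rootA_rootB]

end

open Matrix LieAlgebra

/-! ### From the central extension to matrices -/

section
variable {n : ℕ} {K : Type*} [Field K]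

lemma matA_eq_rootA (i j : Fin n) :
    (matA i j : Matrix _ _ K) = rootA n K (n - 1 - i) (n - 1 - j) := by
  rw [matA_eq, rootA, revUnit_eq_single, revUnit_eq_single]

lemma matB_eq_rootB (i j : Fin n) :
    (matB i j : Matrix _ _ K) = rootB n K (n - 1 - i) (n - 1 - j) := by
  rw [matB_eq, rootB, revUnit_eq_single, revUnit_eq_single]

lemma toBlocks₂₁_lie {X Y : Matrix (Fin n ⊕ Fin n) (Fin n ⊕ Fin n) K} (hX : X.toBlocks₂₁ = 0)
    (hY : Y.toBlocks₂₁ = 0) : (⁅X, Y⁆ : Matrix _ _ K).toBlocks₂₁ = 0 := by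
  rw [← fromBlocks_toBlocks X, ← fromBlocks_toBlocks Y, hX, hY, bracket_fromBlocks]
  simp

/-- `F` pairs upper right blocks with lower left ones, so it cannot see block upper triangular
matrices. -/
lemma formF_eq_zero {X Y : oPi2 n K} (hX : (toMat X).toBlocks₂₁ = 0)
    (hY : (toMat Y).toBlocks₂₁ = 0) : formF n K X Y = 0 := by
  rw [formF_apply, hX, hY]
  simp [upperPairing]

lemma ofTwoCocycle_lie_snd {L M : Type*} [LieRing L] [LieAlgebra K L] [AddCommGroup M] [Module K M]
    [LieRingModule L M] [LieModule K L M] (c : LieModule.Cohomology.twoCocycle K L M)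
    {a b : LieAlgebra.ofTwoCocycle c} (ha : ((ofProd c).symm a).2 = 0)
    (hb : ((ofProd c).symm b).2 = 0) :
    ((ofProd c).symm ⁅a, b⁆).2 = c.1.1 ((ofProd c).symm a).1 ((ofProd c).symm b).1 := by
  rw [bracket_ofTwoCocycle, Equiv.symm_apply_apply, ha, hb, lie_zero, lie_zero, add_zero, sub_zero]

variable [CharP K 2]

variable (K) in
/-- The homomorphism from the free Lie algebra to matrices given by the Chevalley generators. -/
noncomputable def freeToMat (hn : 4 ≤ n) :
    FreeLieAlgebra K (Fin n) →ₗ⁅K⁆ Matrix (Fin n ⊕ Fin n) (Fin n ⊕ Fin n) K :=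
  FreeLieAlgebra.lift K fun i => toMat (xMat hn i)

lemma freeToMat_X_last (hn : 4 ≤ n) : freeToMat K hn (X n K n) = rootB n K 1 0 := by
  rw [X_of_mem (by omega) le_rfl, freeToMat, FreeLieAlgebra.lift_of_apply, xMat,
    dif_neg (by simp only; omega)]
  change matB _ _ = _
  rw [matB_eq_rootB]
  congr 1 <;> simp only <;> omega

lemma chainImage_freeToMat (hn : 4 ≤ n) :
    chainImage (freeToMat K hn) = fun k => rootA n K (k + 1) k := by
  funext k
  rcases Nat.lt_or_ge k (n - 1) with hk | hk
  · rw [chainImage, X_of_mem (by omega) (by omega), freeToMat, FreeLieAlgebra.lift_of_apply, xMat,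
      dif_pos (by simp only; omega)]
    change matA _ _ = _
    rw [matA_eq_rootA]
    congr 1 <;> simp only <;> omega
  · rw [chainImage_eq_zero _ hk, rootA_eq_zero (by omega)]

variable (n K) in
/-- The matrix part of an element of the central extension. -/
def ocToMat : oc n K →ₗ⁅K⁆ Matrix (Fin n ⊕ Fin n) (Fin n ⊕ Fin n) K where
  toFun y := toMat ((ofProd (cocycleF n K)).symm y).1
  map_add' _ _ := rfl
  map_smul' _ _ := rfl
  map_lie' := rfl

lemma lie_snd_eq_zero {a b : oc n K} (ha : ((ofProd (cocycleF n K)).symm a).2 = 0)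
    (ha' : (ocToMat n K a).toBlocks₂₁ = 0) (hb : ((ofProd (cocycleF n K)).symm b).2 = 0)
    (hb' : (ocToMat n K b).toBlocks₂₁ = 0) :
    ((ofProd (cocycleF n K)).symm ⁅a, b⁆).2 = 0 :=
  (ofTwoCocycle_lie_snd _ ha hb).trans
    ((congrArg (TrivialLieModule.equiv K (oPi2 n K) K).symm (formF_eq_zero ha' hb')).trans
      (map_zero _))

variable (n K) in
/-- The elements of the central extension with no central component and with vanishing lower left
block. -/
def ocUpper : LieSubalgebra K (oc n K) where
  carrier := {y | ((ofProd (cocycleF n K)).symm y).2 = 0 ∧ (ocToMat n K y).toBlocks₂₁ = 0}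
  add_mem' := by
    rintro a b ⟨ha, ha'⟩ ⟨hb, hb'⟩
    refine ⟨by rw [of_symm_add, Prod.snd_add, ha, hb, add_zero], ?_⟩
    rw [map_add]
    exact (congrArg₂ (· + ·) ha' hb').trans (add_zero _)
  zero_mem' := ⟨rfl, rfl⟩
  smul_mem' := by
    rintro c a ⟨ha, ha'⟩
    refine ⟨by rw [of_symm_smul, Prod.smul_snd, ha, smul_zero], ?_⟩
    rw [map_smul]
    exact (congrArg (c • ·) ha').trans (smul_zero _)
  lie_mem' := by
    rintro a b ⟨ha, ha'⟩ ⟨hb, hb'⟩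
    refine ⟨lie_snd_eq_zero ha ha' hb hb', ?_⟩
    rw [LieHom.map_lie]
    exact toBlocks₂₁_lie ha' hb'

lemma ocN_le_ocUpper (hn : 4 ≤ n) : ocN K hn ≤ ocUpper n K := by
  refine LieSubalgebra.lieSpan_le.2 ?_
  rintro _ ⟨i, rfl⟩
  refine ⟨rfl, ?_⟩
  change (toMat (xMat hn i)).toBlocks₂₁ = 0
  rw [xMat]
  split_ifs
  · change (matA _ _ : Matrix _ _ K).toBlocks₂₁ = 0
    rw [matA_eq, toBlocks_fromBlocks₂₁]
  · change (matB _ _ : Matrix _ _ K).toBlocks₂₁ = 0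
    rw [matB_eq, toBlocks_fromBlocks₂₁]

/-- The central coordinate is identically zero on `ocN K hn`, so the matrix part determines the
element. -/
lemma ocToMat_eq_zero (hn : 4 ≤ n) {y : oc n K} (hy : y ∈ ocN K hn) (h : ocToMat n K y = 0) :
    y = 0 := by
  refine (ofProd (cocycleF n K)).symm.injective (Prod.ext ?_ (ocN_le_ocUpper hn hy).1)
  exact Subtype.ext (Subtype.ext h)

lemma ocToMat_lift (hn : 4 ≤ n) (y : FreeLieAlgebra K (Fin n)) :
    ocToMat n K (FreeLieAlgebra.lift K (nX K hn) y) = freeToMat K hn y := by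
  have : ((ocToMat n K).comp (ocN K hn).incl).comp (FreeLieAlgebra.lift K (nX K hn)) =
      freeToMat K hn := by
    ext1 i
    simp only [LieHom.comp_apply, FreeLieAlgebra.lift_of_apply, freeToMat]
    rfl
  exact congrArg (fun f : FreeLieAlgebra K (Fin n) →ₗ⁅K⁆ _ => f y) this

lemma lift_nX_eq_zero_iff (hn : 4 ≤ n) (y : FreeLieAlgebra K (Fin n)) :
    FreeLieAlgebra.lift K (nX K hn) y = 0 ↔ freeToMat K hn y = 0 := by
  rw [← ocToMat_lift]
  refine ⟨fun h => by rw [h]; rfl, fun h => Subtype.ext (ocToMat_eq_zero hn (Subtype.prop _) h)⟩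

lemma lift_nX_surjective (hn : 4 ≤ n) : Function.Surjective (FreeLieAlgebra.lift K (nX K hn)) := by
  let g := (ocN K hn).incl.comp (FreeLieAlgebra.lift K (nX K hn))
  have h : ocN K hn ≤ g.range := by
    refine LieSubalgebra.lieSpan_le.2 ?_
    rintro _ ⟨i, rfl⟩
    exact ⟨FreeLieAlgebra.of K i, by simp [g, nX]⟩
  intro y
  obtain ⟨x, hx⟩ := h y.2
  exact ⟨x, Subtype.ext hx⟩

end

/-! ### Quotients and functoriality of the root words -/

section Quotient

variable {K : Type*} [Field K] {L L' : Type*} [LieRing L] [LieAlgebra K L] [LieRing L']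
  [LieAlgebra K L']

/-- The quotient map of a Lie algebra by an ideal, as a homomorphism of Lie algebras. -/
def quotientHom (I : LieIdeal K L) : L →ₗ⁅K⁆ L ⧸ I where
  toLinearMap := (LieSubmodule.Quotient.mk' I : L →ₗ[K] L ⧸ I)
  map_lie' {x y} := LieSubmodule.Quotient.mk_bracket I x y

lemma quotientHom_eq_zero_iff (I : LieIdeal K L) (x : L) : quotientHom I x = 0 ↔ x ∈ I :=
  LieSubmodule.Quotient.mk_eq_zero'

lemma quotientHom_surjective (I : LieIdeal K L) : Function.Surjective (quotientHom I) :=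
  LieSubmodule.Quotient.surjective_mk' I

lemma map_seg (f : L →ₗ⁅K⁆ L') (z : ℕ → L) (q d : ℕ) :
    f (seg z q d) = seg (fun k => f (z k)) q d := by
  induction d with
  | zero => rfl
  | succ d ih => rw [seg, LieHom.map_lie, ih, seg]

lemma map_bent (f : L →ₗ⁅K⁆ L') (z : ℕ → L) (t : L) (i q : ℕ) :
    f (bent z t i q) = bent (fun k => f (z k)) (f t) i q := by
  induction q with
  | zero =>
    rw [bent, map_seg, bent]
    congr 1
    funext k
    exact Function.apply_update (fun _ => f) z 0 t k
  | succ q ih => rw [bent, LieHom.map_lie, ih, bent]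

lemma lieSpan_range_of_surjective {ι : Type*} {f : FreeLieAlgebra K ι →ₗ⁅K⁆ L}
    (hf : Function.Surjective f) :
    LieSubalgebra.lieSpan K L (Set.range fun i => f (FreeLieAlgebra.of K i)) = ⊤ := by
  set S := LieSubalgebra.lieSpan K L (Set.range fun i => f (FreeLieAlgebra.of K i)) with hS
  have h : LieSubalgebra.lieSpan K (FreeLieAlgebra K ι) (Set.range (FreeLieAlgebra.of K)) ≤
      S.comap f := by
    refine LieSubalgebra.lieSpan_le.2 ?_
    rintro _ ⟨i, rfl⟩
    exact LieSubalgebra.subset_lieSpan ⟨i, rfl⟩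
  rw [lieSpan_range_of] at h
  refine eq_top_iff.2 fun y _ => ?_
  obtain ⟨x, rfl⟩ := hf y
  exact h (show x ∈ ⊤ by trivial)

end Quotient

/-! ### Comparison of the presented algebra with the matrices -/

section
variable {n : ℕ} {K : Type*} [Field K] {L : Type*} [LieRing L] [LieAlgebra K L]

lemma seg_eq_zero_of_le {z : ℕ → L} {m : ℕ} (h : ∀ k, m ≤ k → z k = 0) (q d : ℕ)
    (hm : m ≤ q + d) : seg z q d = 0 := by
  cases d with
  | zero => exact h _ hm
  | succ d => rw [seg, h _ (by omega), zero_lie]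

lemma bent_eq_zero_of_le {z : ℕ → L} {t : L} {m : ℕ} (h : ∀ k, m ≤ k → z k = 0) (hm0 : 0 < m)
    (i q : ℕ) (hm : m ≤ i) : bent z t i q = 0 := by
  induction q with
  | zero =>
    refine seg_eq_zero_of_le (m := m) (fun k hk => ?_) 0 i (by omega)
    rw [Function.update_of_ne (by omega), h k hk]
  | succ q ih => rw [bent, ih, lie_zero]

/-- The root elements of a Lie algebra generated by the images of the free generators. -/
noncomputable def rootElement (f : FreeLieAlgebra K (Fin n) →ₗ⁅K⁆ L) :
    RootIndex n ⊕ RootIndex n → L :=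
  Sum.elim (fun x => seg (chainImage f) x.1.2 (x.1.1 - x.1.2 - 1))
    (fun x => bent (chainImage f) (f (X n K n)) (x.1.1 - 1) x.1.2)

/-- With `LieHom.id` the root elements are the universal words in the free Lie algebra; every
homomorphism carries them to the root elements of its target. -/
lemma map_rootElement (f : FreeLieAlgebra K (Fin n) →ₗ⁅K⁆ L) (x : RootIndex n ⊕ RootIndex n) :
    f (rootElement LieHom.id x) = rootElement f x := by
  rcases x with x | x
  · exact map_seg f _ _ _
  · exact map_bent f _ _ _ _

lemma map_sum_rootElement (f : FreeLieAlgebra K (Fin n) →ₗ⁅K⁆ L)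
    (c : RootIndex n ⊕ RootIndex n → K) :
    f (∑ x, c x • rootElement LieHom.id x) = ∑ x, c x • rootElement f x := by
  rw [map_sum]
  exact Finset.sum_congr rfl fun x _ => by rw [map_smul, map_rootElement]

lemma rootElement_freeToMat [CharP K 2] (hn : 4 ≤ n) :
    rootElement (freeToMat K hn) = rootMat n K := by
  funext x
  rcases x with ⟨⟨p, q⟩, h⟩ | ⟨⟨p, q⟩, h⟩
  · have h' : q.val < p.val := h
    simp only [rootElement, rootMat, Sum.elim_inl, chainImage_freeToMat, seg_rootA]
    congr 1
    omega
  · have h' : q.val < p.val := h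
    simp only [rootElement, rootMat, Sum.elim_inr, chainImage_freeToMat, freeToMat_X_last]
    rw [bent_root _ _ (by omega)]
    congr 1
    omega

/-- Cuts the infinite spanning family of the fork down to the finite set of roots: words that reach
index `n - 1` of the chain are zero. -/
lemma span_range_rootElement (hn : 4 ≤ n) {f : FreeLieAlgebra K (Fin n) →ₗ⁅K⁆ L}
    (hf : Function.Surjective f) (hz : IsFork (chainImage f) (f (X n K n))) :
    Submodule.span K (Set.range (rootElement f)) = ⊤ := by
  have hgen : LieSubalgebra.lieSpan K L
      (insert (f (X n K n)) (Set.range (chainImage f))) = ⊤ := by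
    rw [eq_top_iff, ← lieSpan_range_of_surjective hf]
    refine LieSubalgebra.lieSpan_mono ?_
    rintro _ ⟨i, rfl⟩
    simp only [← X_succ]
    rcases eq_or_ne (i.val + 1) n with hi | hi
    · exact .inl (by rw [hi])
    · exact .inr ⟨_, (map_X_eq_chainImage f (by omega)).symm⟩
  rw [eq_top_iff, ← hz.span_rootElement hgen, Submodule.span_le]
  rintro _ (⟨q, d⟩ | ⟨i, q, h⟩)
  · rcases Nat.lt_or_ge (q + d) (n - 1) with hd | hd
    · refine Submodule.subset_span ⟨.inl ⟨(⟨q + d + 1, by omega⟩, ⟨q, by omega⟩), ?_⟩, ?_⟩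
      · simp only [Fin.mk_lt_mk]; omega
      · simp only [rootElement, Sum.elim_inl]
        congr 1
        omega
    · rw [seg_eq_zero_of_le (fun k hk => chainImage_eq_zero f hk) q d hd]
      exact Submodule.zero_mem _
  · rcases Nat.lt_or_ge i (n - 1) with hd | hd
    · refine Submodule.subset_span ⟨.inr ⟨(⟨i + 1, by omega⟩, ⟨q, by omega⟩), ?_⟩, rfl⟩
      simp only [Fin.mk_lt_mk]; omega
    · rw [bent_eq_zero_of_le (fun k hk => chainImage_eq_zero f hk) (by omega) i q hd]
      exact Submodule.zero_mem _

theorem isPresentedBy_nX [CharP K 2] (hn : 4 ≤ n) :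
    IsPresentedBy (nX K hn) (serreRelations n K ∪ nonSerreRelations n K) := by
  refine ⟨lift_nX_surjective hn, le_antisymm (fun y hy => ?_) ?_⟩
  · set I := LieSubmodule.lieSpan K (FreeLieAlgebra K (Fin n))
      (serreRelations n K ∪ nonSerreRelations n K)
    rw [LieHom.mem_ker, lift_nX_eq_zero_iff] at hy
    have hI : ∀ u ∈ I, freeToMat K hn u = 0 := by
      have : I ≤ (freeToMat K hn).ker := LieSubmodule.lieSpan_le.2 fun r hr => by
        refine LieHom.mem_ker.2 (relations_of_isFork _ hn ?_ hr)
        rw [chainImage_freeToMat, freeToMat_X_last]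
        exact isFork_root
      exact fun u hu => LieHom.mem_ker.1 (this hu)
    have hz := isFork_of_relations (quotientHom I) hn fun r hr =>
      (quotientHom_eq_zero_iff I r).2 (LieSubmodule.subset_lieSpan hr)
    have hy' : quotientHom I y ∈ Submodule.span K (Set.range (rootElement (quotientHom I))) := by
      rw [span_range_rootElement hn (quotientHom_surjective I) hz]; trivial
    obtain ⟨c, hc⟩ := (Submodule.mem_span_range_iff_exists_fun K).1 hy'
    -- The expansion in the quotient is lifted to the free algebra, where the matrix homomorphism
    -- can be applied to it.
    have hmem : y - ∑ x, c x • rootElement LieHom.id x ∈ I := by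
      rw [← quotientHom_eq_zero_iff, map_sub, map_sum_rootElement, hc, sub_self]
    -- Both `y` and the ideal `I` map to zero in matrices, hence so does the combination of root
    -- words.
    have hsum : ∑ x, c x • rootMat n K x = 0 := by
      have := hI _ hmem
      rwa [map_sub, hy, zero_sub, neg_eq_zero, map_sum_rootElement,
        rootElement_freeToMat] at this
    rwa [Finset.sum_eq_zero fun x _ => by rw [eq_zero_of_sum_rootMat_eq_zero hsum, zero_smul],
      sub_zero] at hmem
  · refine LieSubmodule.lieSpan_le.2 fun r hr => ?_
    refine LieHom.mem_ker.2 ((lift_nX_eq_zero_iff hn r).2 (relations_of_isFork _ hn ?_ hr))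
    rw [chainImage_freeToMat, freeToMat_X_last]
    exact isFork_root

end
end OrthogonalChar2

theorem theorem8p3 (K : Type*) [Field K] [CharP K 2] (n : ℕ) (hn : 4 ≤ n) :
    OrthogonalChar2.IsPresentedBy (OrthogonalChar2.nX K hn)
      (OrthogonalChar2.serreRelations n K ∪ OrthogonalChar2.nonSerreRelations n K) :=
  OrthogonalChar2.isPresentedBy_nX hn
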